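/- Let $G=(V,E)$ be a finite connected simple undirected graph with $n=|V|$ vertices and maximal degree $\Delta$. In the asynchronous DeGroot dynamics on $G$, every vertex $v\in V$ holds a real opinion $f_t(v)$ at each time $t\ge 0$ and carries a Poisson clock of rate $1$; the clocks are mutually independent and independent of the initial opinions. Whenever the clock of $v$ rings, at time $t$ say, the opinion of $v$ is replaced by the average of the opinions of its neighbours just before $t$, $$f_t(v)=\frac1{\deg v}\sum_{u\sim v}f_{t-}(u),\qquad f_{t-}(u)=\lim_{s\nearrow t}f_s(u),$$ and the opinion of $v$ does not change between rings of its clock. For $\varepsilon>0$ let $$\tau_\varepsilon=\min\Big\{t\ge 0:\ \max_{v\in V}f_t(v)-\min_{v\in V}f_t(v)\le\varepsilon\Big\}$$ be the $\varepsilon$-consensus time (with $\tau_\varepsilon=\infty$ if there is no such $t$). There is a universal constant $C>0$, and for every $\Delta$ there is an integer $n_0(\Delta)$, such that the following holds. If $n\ge n_0(\Delta)$ and the initial opinions $(f_0(v))_{v\in V}$ are i.i.d. random variables with values in $[0,1]$, then for every $\varepsilon>0$ $$\mathbb E[\tau_\varepsilon]\le\big(\varepsilon^{-1}\log n\big)^{C}.$$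 -/

import Mathlib

open MeasureTheory ProbabilityTheory Filter Topology
open scoped NNReal ENNReal

namespace DeGroot

/-- The transition matrix of the simple random walk on `G`. -/
noncomputable def simpleRandomWalk {V : Type*} [Fintype V] (G : SimpleGraph V)
    [DecidableRel G.Adj] : Matrix V V ℝ :=
  Matrix.of fun v u => if G.Adj v u then (G.degree v : ℝ)⁻¹ else 0

/-- A Poisson clock of rate `1`, identified with its counting function: `N t ω` is the number of
rings in the time interval `[0, t]`. -/
structure IsPoissonClock {Ω : Type*} [MeasurableSpace Ω] (N : ℝ≥0 → Ω → ℕ) (P : Measure Ω) :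
    Prop where
  measurable : ∀ t, Measurable (N t)
  zero : ∀ᵐ ω ∂P, N 0 ω = 0
  mono : ∀ᵐ ω ∂P, Monotone fun t => N t ω
  rightCont : ∀ᵐ ω ∂P, ∀ t, ContinuousWithinAt (fun s => N s ω) (Set.Ici t) t
  indepIncrements : HasIndepIncrements N P
  law : ∀ s t, s ≤ t → HasLaw (fun ω => N t ω - N s ω) (poissonMeasure (t - s)) P

/-- The clock whose counting function is `N` rings at time `t`. -/
def RingsAt (N : ℝ≥0 → ℕ) (t : ℝ≥0) : Prop :=
  0 < t ∧ ∀ s < t, N s < N t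

/-- The trajectory `f` of opinions follows the asynchronous DeGroot rule for the matrix `K` and the
clocks with counting functions `N v`: an opinion stays put as long as its own clock does not ring,
and when the clock of `v` rings at time `t`, the new opinion of `v` is the `K`-average of the
opinions just before time `t`. -/
structure IsDeGrootPath {V : Type*} [Fintype V] (K : Matrix V V ℝ) (N : V → ℝ≥0 → ℕ)
    (f : ℝ≥0 → V → ℝ) : Prop where
  constant : ∀ v s t, s ≤ t → N v s = N v t → f t v = f s v
  update : ∀ v t, RingsAt (N v) t → ∃ g : V → ℝ,
    (∀ u, Tendsto (fun s => f s u) (𝓝[<] t) (𝓝 (g u))) ∧ f t v = ∑ u, K v u * g u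

/-- The asynchronous DeGroot dynamics with transition matrix `K`: `f t v` is the opinion of `v` at
time `t`, and `N v t` is the number of rings of the clock of `v` up to time `t`. The clocks are
independent Poisson clocks of rate `1`, and they are independent of the initial opinions. -/
structure IsDeGrootDynamics {V Ω : Type*} [Fintype V] [MeasurableSpace Ω] (K : Matrix V V ℝ)
    (N : V → ℝ≥0 → Ω → ℕ) (f : ℝ≥0 → V → Ω → ℝ) (P : Measure Ω) : Prop where
  clock : ∀ v, IsPoissonClock (N v) P
  iIndep_clock : iIndepFun (fun v ω t => N v t ω) P
  indep_init : IndepFun (fun ω v => f 0 v ω) (fun ω v t => N v t ω) P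
  aemeasurable : ∀ t v, AEMeasurable (f t v) P
  path : ∀ᵐ ω ∂P, IsDeGrootPath K (fun v t => N v t ω) (fun t v => f t v ω)

/-- The initial opinions are i.i.d. random variables with values in `[0, 1]`. -/
structure IIDInit {V Ω : Type*} [MeasurableSpace Ω] (f₀ : V → Ω → ℝ) (P : Measure Ω) : Prop where
  indep : iIndepFun f₀ P
  identDistrib : ∀ u v, IdentDistrib (f₀ u) (f₀ v) P P
  mem_Icc : ∀ v, ∀ᵐ ω ∂P, f₀ v ω ∈ Set.Icc (0 : ℝ) 1

/-- The oscillation `max g - min g` of a function on a finite nonempty set. -/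
noncomputable def osc {V : Type*} (g : V → ℝ) : ℝ :=
  (⨆ v, g v) - ⨅ v, g v

/-- The `ε`-consensus time of a trajectory: the first time at which the oscillation is at most
`ε`, and `∞` if there is no such time. -/
noncomputable def consensusTime {V : Type*} (ε : ℝ) (f : ℝ≥0 → V → ℝ) : ℝ≥0∞ :=
  ⨅ (t : ℝ≥0) (_ : osc (f t) ≤ ε), (t : ℝ≥0∞)

end DeGroot

/-! The opinions at time T are a random linear image of the initial ones: f_T(v) = Σ_u f_0(u)
a_u(v), where a_u is the dynamics with the same rings started from the indicator of u, and Σ_u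
a_u(v) = 1. The rings are independent of f_0. So if every a_u(v) is at most δ, then Σ_u a_u(v)^2 ≤
δ, and Hoeffding's inequality puts all f_T(v) close to their common mean
(`measureReal_largeOsc_le_of_forall_le`). It remains to flatten an indicator in polylogarithmic
time.

A ring at v lowers the Dirichlet energy E by deg(v)·defect(v)^2 and changes the degree-weighted mass
M by -deg(v)·defect(v). Averaged over v the second change vanishes, so M is a martingale whose
fluctuations are paid for by the loss of energy. Hence exp(θ(E+M)) is a supermartingale for small θ
(`sum_ringWeight_mul_exp_le`), and M rarely exceeds a level L of order Δ log n. While M ≤ L and max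
f > δ, few vertices exceed δ/2, and this forces a dissipation of order δ^6/L^3 (`le_dissipation`).
The supermartingale therefore decays exponentially until max f ≤ δ
(`sum_patternWeight_single_gt_le`).

The resulting bound on the probability of disagreement does not decay in time, so it cannot be
summed. A Poincaré inequality gives, for all initial opinions in [0,1], exponential decay at the
slow rate 1/(n^2 Δ), up to a constant; the geometric mean of the two bounds is summable with a small
sum (`tsum_ofReal_le`). If n is too small for the level-set argument, then n is itself polynomial in
ε⁻¹ log n and the slow decay suffices.

The Poisson clocks enter through time slots of length h → 0 with at most one ring each, so
expectations become finite sums over ring patterns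
(`IsDeGrootDynamics.measureReal_le_of_forall_pattern`). -/

namespace DeGroot

open Matrix

/-! ### Ring updates as linear maps -/

section Update

variable {V : Type*} [Fintype V] [DecidableEq V]

/-- One step of the dynamics with matrix `K`: nothing happens (`none`), or the opinion of `v` is
replaced by its `K`-average (`some v`). -/
def ringUpdate (K : Matrix V V ℝ) : Option V → (V → ℝ) →ₗ[ℝ] (V → ℝ)
  | none => LinearMap.id
  | some v =>
    { toFun := fun f => Function.update f v (∑ u, K v u * f u)
      map_add' := fun f g => by
        ext w
        by_cases h : w = v
        · subst h; simp [mul_add, Finset.sum_add_distrib]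
        · simp [h]
      map_smul' := fun c f => by
        ext w
        by_cases h : w = v
        · subst h; simp [Finset.mul_sum, mul_left_comm]
        · simp [h] }

/-- The composition of the steps listed by `σ`, the step `σ 0` being the first one. -/
def ringUpdates (K : Matrix V V ℝ) : (m : ℕ) → (Fin m → Option V) → (V → ℝ) →ₗ[ℝ] (V → ℝ)
  | 0, _ => LinearMap.id
  | m + 1, σ => (ringUpdates K m (Fin.tail σ)).comp (ringUpdate K (σ 0))

@[simp] lemma ringUpdate_none (K : Matrix V V ℝ) (f : V → ℝ) : ringUpdate K none f = f := rfl

lemma ringUpdate_some (K : Matrix V V ℝ) (v : V) (f : V → ℝ) :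
    ringUpdate K (some v) f = Function.update f v (∑ u, K v u * f u) := rfl

lemma ringUpdates_succ (K : Matrix V V ℝ) (m : ℕ) (σ : Fin (m + 1) → Option V) (f : V → ℝ) :
    ringUpdates K (m + 1) σ f = ringUpdates K m (Fin.tail σ) (ringUpdate K (σ 0) f) := rfl

lemma ringUpdates_eq_of_forall (K : Matrix V V ℝ) (m : ℕ) (σ : Fin m → Option V)
    (g : ℕ → V → ℝ) (h : ∀ k : Fin m, g (k + 1) = ringUpdate K (σ k) (g k)) :
    g m = ringUpdates K m σ (g 0) := by
  induction m generalizing g with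
  | zero => rfl
  | succ m ih =>
    have h0 := h 0
    simp only [Fin.val_zero, zero_add] at h0
    rw [ringUpdates_succ, ← h0]
    exact ih (Fin.tail σ) (fun k => g (k + 1)) fun k => by simpa [Fin.tail] using h k.succ

lemma ringUpdates_induction (K : Matrix V V ℝ) (I : (V → ℝ) → Prop)
    (hI : ∀ o f, I f → I (ringUpdate K o f)) (m : ℕ) (σ : Fin m → Option V) (f : V → ℝ)
    (hf : I f) : I (ringUpdates K m σ f) := by
  induction m generalizing f with
  | zero => exact hf
  | succ m ih => exact ih _ _ (hI _ _ hf)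

/-- By linearity, the dynamics started from indicators supplies the weights with which the initial
opinions enter the later ones. -/
lemma ringUpdates_apply_eq_sum (K : Matrix V V ℝ) (m : ℕ) (σ : Fin m → Option V) (f : V → ℝ)
    (v : V) :
    ringUpdates K m σ f v = ∑ u, f u * ringUpdates K m σ (Pi.single u 1) v := by
  rw [(ringUpdates K m σ).pi_apply_eq_sum_univ f, Finset.sum_apply]
  simp only [Pi.smul_apply, smul_eq_mul]
  refine Finset.sum_congr rfl fun u _ => ?_
  have : (fun j => if u = j then (1 : ℝ) else 0) = Pi.single u 1 := by
    ext j; simp [Pi.single_apply, eq_comm]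
  rw [this]

end Update

/-! ### Dirichlet energy, mass and dissipation -/

section Energy

/-- Cauchy–Schwarz along the walk, stopped at its first vertex below level s: every edge used starts
in {f ≥ s}, so only such vertices are counted. -/
lemma sq_sub_le_of_walk {V : Type*} {G : SimpleGraph V} (f : V → ℝ) (s : ℝ) {a b : V}
    (p : G.Walk a b) (ha : s ≤ f a)
    (hb : f b ≤ s) :
    (f a - s) ^ 2 ≤ (p.support.filter (fun w => s ≤ f w)).length
      * (p.darts.map fun d => (f d.fst - f d.snd) ^ 2).sum := by
  induction p with
  | nil => simp [le_antisymm hb ha]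
  | @cons a a' b hadj p ih =>
    have hS : 0 ≤ (p.darts.map fun d => (f d.fst - f d.snd) ^ 2).sum :=
      List.sum_nonneg (by simp only [List.mem_map]; rintro _ ⟨d, -, rfl⟩; positivity)
    simp only [SimpleGraph.Walk.support_cons, SimpleGraph.Walk.darts_cons, List.map_cons,
      List.sum_cons, List.filter_cons, ha, decide_true, if_true, List.length_cons, Nat.cast_add,
      Nat.cast_one]
    set S := (p.darts.map fun d => (f d.fst - f d.snd) ^ 2).sum
    set c : ℝ := ((p.support.filter (fun w => s ≤ f w)).length : ℝ)
    have hc : 0 ≤ c := Nat.cast_nonneg _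
    by_cases h : s ≤ f a'
    · have ih' := ih h hb
      have h1 : (f a - s) = (f a - f a') + (f a' - s) := by ring
      rw [h1]
      set x := f a - f a'
      set y := f a' - s
      have hy : y ^ 2 ≤ c * S := ih'
      by_cases hS0 : c = 0
      · have : y = 0 := by rw [hS0] at hy; nlinarith
        rw [hS0, this]; nlinarith
      · have hc' : 0 < c := lt_of_le_of_ne hc (Ne.symm hS0)
        -- The inductive form of Cauchy–Schwarz: c(cx² + S) ≥ (cx)² + y² ≥ 2cxy.
        have h2 : 2 * x * y ≤ c * x ^ 2 + S := by
          by_contra! hcon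
          have h3 : c * (c * x ^ 2 + S) < c * (2 * x * y) := mul_lt_mul_of_pos_left hcon hc'
          nlinarith [sq_nonneg (c * x - y)]
        nlinarith
    · push Not at h
      have h1 : (f a - s) ^ 2 ≤ (f a - f a') ^ 2 := by
        apply pow_le_pow_left₀ <;> linarith
      have := mul_nonneg hc hS
      have := mul_nonneg hc (sq_nonneg (f a - f a'))
      nlinarith

variable {V : Type*} [Fintype V] (G : SimpleGraph V) [DecidableRel G.Adj]

/-- The total mass of `f` with respect to the degree measure. -/
noncomputable def mass (f : V → ℝ) : ℝ := ∑ v, (G.degree v : ℝ) * f v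

/-- The difference between `f v` and the average of `f` over the neighbours of `v`. -/
noncomputable def defect (f : V → ℝ) (v : V) : ℝ := f v - ∑ u, simpleRandomWalk G v u * f u

/-- The squared norm of the defect with respect to the degree measure. -/
noncomputable def dissipation (f : V → ℝ) : ℝ := ∑ v, (G.degree v : ℝ) * defect G f v ^ 2

lemma dissipation_nonneg (f : V → ℝ) : 0 ≤ dissipation G f :=
  Finset.sum_nonneg fun _ _ => by positivity

variable [DecidableEq V]

/-- The Dirichlet energy of `f`. -/
noncomputable def energy (f : V → ℝ) : ℝ := f ⬝ᵥ G.lapMatrix ℝ *ᵥ f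

lemma energy_eq_sum (f : V → ℝ) :
    energy G f = (∑ i, ∑ j, if G.Adj i j then (f i - f j) ^ 2 else 0) / 2 := by
  rw [← SimpleGraph.lapMatrix_toLinearMap₂', Matrix.toLinearMap₂'_apply']; rfl

lemma energy_nonneg (f : V → ℝ) : 0 ≤ energy G f := by
  rw [energy_eq_sum]
  refine div_nonneg (Finset.sum_nonneg fun i _ => Finset.sum_nonneg fun j _ => ?_) zero_le_two
  split_ifs <;> positivity

lemma lapMatrix_mulVec_eq (f : V → ℝ) (v : V) :
    (G.lapMatrix ℝ *ᵥ f) v = G.degree v * defect G f v := by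
  rw [SimpleGraph.lapMatrix_mulVec_apply, defect, mul_sub, Finset.mul_sum]
  congr 1
  rw [← Finset.sum_filter_add_sum_filter_not Finset.univ (G.Adj v)]
  rw [Finset.sum_eq_zero (s := Finset.univ.filter fun u => ¬ G.Adj v u), add_zero,
    ← SimpleGraph.neighborFinset_eq_filter]
  · refine Finset.sum_congr rfl fun u hu => ?_
    have hu' : G.Adj v u := by simpa using hu
    have : (G.degree v : ℝ) ≠ 0 := by
      exact_mod_cast ((G.degree_pos_iff_exists_adj v).2 ⟨u, hu'⟩).ne'
    simp [simpleRandomWalk, hu', this]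
  · intro u hu
    simp [simpleRandomWalk, (Finset.mem_filter.1 hu).2]

/-- The update subtracts d·1_v with d the defect at v. In the Laplacian form the cross term is
-2·deg(v)·d² and the square term is deg(v)·d². -/
lemma energy_ringUpdate (f : V → ℝ) (v : V) :
    energy G (ringUpdate (simpleRandomWalk G) (some v) f)
      = energy G f - G.degree v * defect G f v ^ 2 := by
  have h : ringUpdate (simpleRandomWalk G) (some v) f = f - defect G f v • Pi.single v 1 := by
    ext w
    rw [ringUpdate_some]
    by_cases hw : w = v
    · subst hw; simp [defect]
    · simp [hw]
  have hs : ∀ g : V → ℝ, g ⬝ᵥ G.lapMatrix ℝ *ᵥ (Pi.single v 1) = (G.lapMatrix ℝ *ᵥ g) v := by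
    intro g
    rw [Matrix.dotProduct_mulVec, ← Matrix.mulVec_transpose, (G.isSymm_lapMatrix (R := ℝ)).eq]
    simp
  have hd : (G.lapMatrix ℝ *ᵥ Pi.single v (1 : ℝ)) v = G.degree v := by
    simp [SimpleGraph.lapMatrix_mulVec_apply]
  rw [h, energy, Matrix.mulVec_sub, Matrix.mulVec_smul, sub_dotProduct, dotProduct_sub,
    dotProduct_sub, dotProduct_smul, smul_dotProduct, smul_dotProduct, dotProduct_smul, hs, hs, hd,
    single_dotProduct, lapMatrix_mulVec_eq, energy]
  simp only [smul_eq_mul]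
  ring

lemma mass_ringUpdate (f : V → ℝ) (v : V) :
    mass G (ringUpdate (simpleRandomWalk G) (some v) f)
      = mass G f - G.degree v * defect G f v := by
  have h : ∀ w, (G.degree w : ℝ) * ringUpdate (simpleRandomWalk G) (some v) f w
      = G.degree w * f w - if w = v then G.degree v * defect G f v else 0 := by
    intro w
    rw [ringUpdate_some]
    by_cases hw : w = v
    · subst hw; simp [defect]; ring
    · simp [hw]
  simp [mass, h]

/-- The symmetric Laplacian kills constants. Together with `mass_ringUpdate`, this says that the
mass has no drift. -/
lemma sum_degree_mul_defect (f : V → ℝ) : ∑ v, (G.degree v : ℝ) * defect G f v = 0 := by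
  simp_rw [← lapMatrix_mulVec_eq]
  have : ∑ v, (G.lapMatrix ℝ *ᵥ f) v = (fun _ => (1 : ℝ)) ⬝ᵥ G.lapMatrix ℝ *ᵥ f := by
    simp [dotProduct]
  rw [this, Matrix.dotProduct_mulVec, ← Matrix.mulVec_transpose, (G.isSymm_lapMatrix (R := ℝ)).eq,
    G.lapMatrix_mulVec_const_eq_zero, zero_dotProduct]

/-- Cauchy–Schwarz for E = Σ deg·(f - c)·defect; the constant c is free because the degree-weighted
defects sum to zero. -/
lemma energy_sq_le (f : V → ℝ) (c : ℝ) :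
    energy G f ^ 2 ≤ (∑ v, (G.degree v : ℝ) * (f v - c) ^ 2) * dissipation G f := by
  have h : energy G f = ∑ v, (√(G.degree v) * (f v - c)) * (√(G.degree v) * defect G f v) := by
    have h1 : energy G f = ∑ v, f v * (G.degree v * defect G f v) := by
      simp [energy, dotProduct, lapMatrix_mulVec_eq]
    have h2 : ∑ v, c * (G.degree v * defect G f v) = 0 := by
      rw [← Finset.mul_sum, sum_degree_mul_defect, mul_zero]
    rw [h1, ← sub_zero (∑ v, f v * _), ← h2, ← Finset.sum_sub_distrib]
    refine Finset.sum_congr rfl fun v _ => ?_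
    have := Real.mul_self_sqrt (Nat.cast_nonneg (α := ℝ) (G.degree v))
    linear_combination (- (f v - c) * defect G f v) * this
  rw [h]
  refine (Finset.sum_mul_sq_le_sq_mul_sq _ _ _).trans_eq ?_
  simp_rw [mul_pow, Real.sq_sqrt (Nat.cast_nonneg (α := ℝ) (G.degree _))]
  rfl

variable {G}

lemma darts_sum_le_energy (f : V → ℝ) {a b : V} (p : G.Walk a b) (hp : p.IsPath) :
    (p.darts.map fun d => (f d.fst - f d.snd) ^ 2).sum ≤ 2 * energy G f := by
  have hnd : p.darts.Nodup := List.Nodup.of_map _ hp.isTrail.edges_nodup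
  have hinj : Function.Injective (fun d : G.Dart => d.toProd) := fun d d' h =>
    SimpleGraph.Dart.ext d d' h
  have h1 : (p.darts.map fun d => (f d.fst - f d.snd) ^ 2).sum
      = ∑ x ∈ (p.darts.map fun d => d.toProd).toFinset, (f x.1 - f x.2) ^ 2 := by
    rw [List.sum_toFinset _ (hnd.map hinj), List.map_map]; rfl
  rw [h1, energy_eq_sum, mul_div_cancel₀ _ two_ne_zero, ← Finset.sum_product',
    Finset.univ_product_univ, ← Finset.sum_filter]
  refine Finset.sum_le_sum_of_subset_of_nonneg ?_ fun _ _ _ => by positivity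
  intro x hx
  simp only [List.mem_toFinset, List.mem_map] at hx
  obtain ⟨d, -, rfl⟩ := hx
  simp [d.adj]

/-- Used in two ways: with s a minimum or another value of f it is a Poincaré estimate with factor
n; with s = δ/2 only the small set {f ≥ δ/2} enters, which makes the bound nearly independent of n.
-/
lemma sq_sub_le_card_mul_energy (hG : G.Connected) (f : V → ℝ) (s : ℝ) {a b : V} (ha : s ≤ f a)
    (hb : f b ≤ s) :
    (f a - s) ^ 2 ≤ (Finset.univ.filter fun w => s ≤ f w).card * (2 * energy G f) := by
  obtain ⟨p, hp⟩ := (hG.preconnected a b).exists_isPath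
  refine (sq_sub_le_of_walk f s p ha hb).trans ?_
  gcongr
  · exact List.sum_nonneg (by simp only [List.mem_map]; rintro _ ⟨d, -, rfl⟩; positivity)
  · rw [← List.toFinset_card_of_nodup (hp.support_nodup.filter _)]
    apply Finset.card_le_card
    intro w hw
    simpa using (List.mem_filter.1 (List.mem_toFinset.1 hw)).2
  · exact darts_sum_le_energy f p hp

end Energy

/-! ### Weights of ring patterns in discretized time -/

section Pattern

variable {V : Type*} [Fintype V]

/-- The probability that, during a time interval of length `h`, no clock rings (`none`), or that the
clock of a given vertex rings once and no other clock rings. -/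
noncomputable def ringWeight (h : ℝ) : Option V → ℝ
  | none => Real.exp (-(Fintype.card V * h))
  | some _ => h * Real.exp (-(Fintype.card V * h))

/-- The probability that `m` successive time intervals of length `h` show the rings listed
by `σ`. -/
noncomputable def patternWeight (h : ℝ) {m : ℕ} (σ : Fin m → Option V) : ℝ :=
  ∏ k, ringWeight h (σ k)

lemma ringWeight_nonneg {h : ℝ} (hh : 0 ≤ h) (o : Option V) : 0 ≤ ringWeight h o := by
  cases o <;> simp only [ringWeight] <;> positivity

lemma patternWeight_nonneg {h : ℝ} (hh : 0 ≤ h) {m : ℕ} (σ : Fin m → Option V) :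
    0 ≤ patternWeight h σ :=
  Finset.prod_nonneg fun _ _ => ringWeight_nonneg hh _

lemma sum_ringWeight (h : ℝ) :
    ∑ o : Option V, ringWeight h o
      = (1 + Fintype.card V * h) * Real.exp (-(Fintype.card V * h)) := by
  simp [Fintype.sum_option, ringWeight]; ring

lemma sum_ringWeight_le_one (h : ℝ) : ∑ o : Option V, ringWeight h o ≤ 1 := by
  rw [sum_ringWeight, Real.exp_neg, ← div_eq_mul_inv, div_le_one (Real.exp_pos _), add_comm]
  exact Real.add_one_le_exp _

lemma one_sub_sq_le_sum_ringWeight {h : ℝ} (hh : 0 ≤ h) :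
    1 - (Fintype.card V * h) ^ 2 ≤ ∑ o : Option V, ringWeight h o := by
  rw [sum_ringWeight]
  have h1 : 0 ≤ Fintype.card V * h := by positivity
  nlinarith [Real.add_one_le_exp (-(Fintype.card V * h))]

lemma sum_fin_succ_option {m : ℕ} (F : (Fin (m + 1) → Option V) → ℝ) :
    ∑ σ, F σ = ∑ o, ∑ τ, F (Fin.cons o τ) := by
  rw [← (Fin.consEquiv (fun _ => Option V)).sum_comp, Fintype.sum_prod_type]
  rfl

lemma patternWeight_cons (h : ℝ) {m : ℕ} (o : Option V) (τ : Fin m → Option V) :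
    patternWeight h (Fin.cons o τ : Fin (m + 1) → Option V)
      = ringWeight h o * patternWeight h τ := by
  simp [patternWeight, Fin.prod_univ_succ]

lemma sum_patternWeight (h : ℝ) (m : ℕ) :
    ∑ σ : Fin m → Option V, patternWeight h σ = (∑ o : Option V, ringWeight h o) ^ m := by
  simp [patternWeight, ← Fintype.piFinset_univ, Finset.sum_prod_piFinset]

lemma sum_patternWeight_le_one {h : ℝ} (hh : 0 ≤ h) (m : ℕ) :
    ∑ σ : Fin m → Option V, patternWeight h σ ≤ 1 := by
  rw [sum_patternWeight]
  exact pow_le_one₀ (Finset.sum_nonneg fun _ _ => ringWeight_nonneg hh _) (sum_ringWeight_le_one h)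

/-- The missing weight is the probability of at least two rings in some slot. It vanishes as h → 0
with m·h fixed. -/
lemma one_sub_le_sum_patternWeight {h : ℝ} (hh : 0 ≤ h) (hh1 : Fintype.card V * h ≤ 1) (m : ℕ) :
    1 - m * (Fintype.card V * h) ^ 2 ≤ ∑ σ : Fin m → Option V, patternWeight h σ := by
  rw [sum_patternWeight]
  have h0 : 0 ≤ Fintype.card V * h := by positivity
  have h1 : (Fintype.card V * h) ^ 2 ≤ 1 := pow_le_one₀ h0 hh1
  calc 1 - m * (Fintype.card V * h) ^ 2 = 1 + m * (-(Fintype.card V * h) ^ 2) := by ring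
    _ ≤ (1 + -(Fintype.card V * h) ^ 2) ^ m := one_add_mul_le_pow (by linarith) m
    _ ≤ _ := by
      refine pow_le_pow_left₀ (by linarith) ?_ m
      rw [← sub_eq_add_neg]
      exact one_sub_sq_le_sum_ringWeight hh

variable [DecidableEq V]

/-- A drift inequality for one step propagates to `m` steps. -/
lemma sum_patternWeight_mul_le {K : Matrix V V ℝ} {I : (V → ℝ) → Prop}
    (hI : ∀ o f, I f → I (ringUpdate K o f)) {h : ℝ} (hh : 0 ≤ h) {φ ψ : (V → ℝ) → ℝ} {κ e : ℝ}
    (hκ0 : 0 ≤ κ) (hκ : κ ≤ 1) (he : 0 ≤ e)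
    (hφ : ∀ f, I f → ∑ o, ringWeight h o * φ (ringUpdate K o f) ≤ (1 - κ) * φ f + κ * e * ψ f)
    (hψ : ∀ f, I f → ∑ o, ringWeight h o * ψ (ringUpdate K o f) ≤ ψ f)
    (m : ℕ) (f : V → ℝ) (hf : I f) :
    ∑ σ : Fin m → Option V, patternWeight h σ * φ (ringUpdates K m σ f)
      ≤ (1 - κ) ^ m * φ f + e * (1 - (1 - κ) ^ m) * ψ f := by
  induction m generalizing f with
  | zero => simp [patternWeight, ringUpdates]
  | succ m ih =>
    have h0 : 0 ≤ (1 - κ) ^ m := pow_nonneg (by linarith) m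
    have h1 : (1 - κ) ^ m ≤ 1 := pow_le_one₀ (by linarith) (by linarith)
    rw [sum_fin_succ_option]
    simp only [patternWeight_cons, ringUpdates_succ, Fin.cons_zero, Fin.tail_cons]
    calc ∑ o : Option V, ∑ τ : Fin m → Option V, ringWeight h o * patternWeight h τ
            * φ (ringUpdates K m τ (ringUpdate K o f))
        = ∑ o : Option V, ringWeight h o * ∑ τ : Fin m → Option V, patternWeight h τ
            * φ (ringUpdates K m τ (ringUpdate K o f)) := by
          simp_rw [Finset.mul_sum, mul_assoc]
      _ ≤ ∑ o : Option V, ringWeight h o * ((1 - κ) ^ m * φ (ringUpdate K o f)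
            + e * (1 - (1 - κ) ^ m) * ψ (ringUpdate K o f)) :=
          Finset.sum_le_sum fun o _ =>
            mul_le_mul_of_nonneg_left (ih _ (hI o f hf)) (ringWeight_nonneg hh o)
      _ = (1 - κ) ^ m * ∑ o : Option V, ringWeight h o * φ (ringUpdate K o f)
            + e * (1 - (1 - κ) ^ m) * ∑ o : Option V, ringWeight h o * ψ (ringUpdate K o f) := by
          rw [Finset.mul_sum, Finset.mul_sum, ← Finset.sum_add_distrib]
          exact Finset.sum_congr rfl fun o _ => by ring
      _ ≤ (1 - κ) ^ m * ((1 - κ) * φ f + κ * e * ψ f) + e * (1 - (1 - κ) ^ m) * ψ f :=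
          add_le_add (mul_le_mul_of_nonneg_left (hφ f hf) h0)
            (mul_le_mul_of_nonneg_left (hψ f hf) (mul_nonneg he (by linarith)))
      _ = _ := by ring

end Pattern

/-! ### One-step drift and flattening of indicators -/

section Drift

variable {V : Type*} [Fintype V] {G : SimpleGraph V} [DecidableRel G.Adj]

lemma exp_neg_mul_one_add_sub_le {x y : ℝ} (hx : x ≤ 1 / 2) (hy : 0 ≤ y) :
    Real.exp (-x) * (1 + x - y) ≤ 1 - y / 2 := by
  have h1 : Real.exp (-x) * (1 + x) ≤ 1 := by
    rw [Real.exp_neg, inv_mul_le_iff₀ (Real.exp_pos _), mul_one, add_comm]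
    exact Real.add_one_le_exp _
  have h2 := Real.add_one_le_exp (-x)
  nlinarith

lemma simpleRandomWalk_nonneg (v u : V) : 0 ≤ simpleRandomWalk G v u := by
  simp only [simpleRandomWalk, Matrix.of_apply]
  split_ifs <;> positivity

lemma sum_simpleRandomWalk {v : V} (hv : 0 < G.degree v) : ∑ u, simpleRandomWalk G v u = 1 := by
  classical
  have h : ((G.degree v : ℕ) : ℝ) ≠ 0 := by exact_mod_cast hv.ne'
  simp only [simpleRandomWalk, Matrix.of_apply, ← Finset.sum_filter, Finset.sum_const,
    nsmul_eq_mul, ← SimpleGraph.neighborFinset_eq_filter, SimpleGraph.card_neighborFinset_eq_degree]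
  exact mul_inv_cancel₀ h

lemma degree_pos_of_connected (hG : G.Connected) [Nontrivial V] (v : V) : 0 < G.degree v :=
  hG.preconnected.degree_pos_of_nontrivial v

lemma mass_nonneg {f : V → ℝ} (hf : 0 ≤ f) : 0 ≤ mass G f :=
  Finset.sum_nonneg fun v _ => mul_nonneg (Nat.cast_nonneg _) (hf v)

variable [DecidableEq V]

lemma ringUpdate_one (hd : ∀ v, 0 < G.degree v) (o : Option V) :
    ringUpdate (simpleRandomWalk G) o 1 = 1 := by
  cases o with
  | none => rfl
  | some v =>
    ext w
    rw [ringUpdate_some]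
    by_cases h : w = v
    · subst h; simp [sum_simpleRandomWalk (hd w)]
    · simp [h]

lemma ringUpdate_mono {K : Matrix V V ℝ} (hK : ∀ v u, 0 ≤ K v u) (o : Option V) {f g : V → ℝ}
    (h : f ≤ g) : ringUpdate K o f ≤ ringUpdate K o g := by
  cases o with
  | none => exact h
  | some v =>
    intro w
    simp only [ringUpdate_some]
    by_cases hw : w = v
    · subst hw
      simpa using Finset.sum_le_sum fun u _ => mul_le_mul_of_nonneg_left (h u) (hK w u)
    · simpa [hw] using h w

lemma ringUpdate_nonneg (o : Option V) {f : V → ℝ} (h : 0 ≤ f) :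
    0 ≤ ringUpdate (simpleRandomWalk G) o f := by
  simpa using ringUpdate_mono (simpleRandomWalk_nonneg (G := G)) o h

lemma ringUpdate_le (hd : ∀ v, 0 < G.degree v) (o : Option V) {f : V → ℝ} {M : ℝ}
    (h : ∀ v, f v ≤ M) (v : V) : ringUpdate (simpleRandomWalk G) o f v ≤ M := by
  have h1 := ringUpdate_mono (simpleRandomWalk_nonneg (G := G)) o (f := f) (g := M • 1)
    (fun v => by simpa using h v)
  rw [map_smul, ringUpdate_one hd] at h1
  simpa using h1 v

/-- Take c = min f in `energy_sq_le`: each (f v - c)² is at most 2nE, so E² is at most a multiple of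
E times the dissipation, and E cancels. -/
lemma energy_le_dissipation (hG : G.Connected) (f : V → ℝ) :
    energy G f ≤ 2 * Fintype.card V ^ 2 * G.maxDegree * dissipation G f := by
  have := hG.nonempty
  obtain ⟨b, hb⟩ := Finite.exists_min f
  have h1 : ∀ v, (f v - f b) ^ 2 ≤ Fintype.card V * (2 * energy G f) := fun v =>
    (sq_sub_le_card_mul_energy hG f (f b) (hb v) le_rfl).trans (by
      have := energy_nonneg G f
      gcongr
      exact Finset.card_le_univ _)
  have h2 : ∑ v, (G.degree v : ℝ) * (f v - f b) ^ 2
      ≤ 2 * Fintype.card V ^ 2 * G.maxDegree * energy G f := by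
    calc ∑ v, (G.degree v : ℝ) * (f v - f b) ^ 2
        ≤ ∑ _v : V, (G.maxDegree : ℝ) * (Fintype.card V * (2 * energy G f)) := by
          refine Finset.sum_le_sum fun v _ => mul_le_mul ?_ (h1 v) (sq_nonneg _) (by positivity)
          exact_mod_cast G.degree_le_maxDegree v
      _ = _ := by simp; ring
  have h3 := (energy_sq_le G f (f b)).trans
    (mul_le_mul_of_nonneg_right h2 (dissipation_nonneg G f))
  have hE := energy_nonneg G f
  rcases hE.eq_or_lt with h0 | h0
  · rw [← h0]
    have := dissipation_nonneg G f
    positivity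
  · nlinarith

lemma sum_ringWeight_mul_energy (h : ℝ) (f : V → ℝ) :
    ∑ o, ringWeight h o * energy G (ringUpdate (simpleRandomWalk G) o f)
      = Real.exp (-(Fintype.card V * h))
        * ((1 + Fintype.card V * h) * energy G f - h * dissipation G f) := by
  simp only [Fintype.sum_option, ringWeight, ringUpdate_none, energy_ringUpdate, ← Finset.mul_sum,
    Finset.sum_sub_distrib]
  simp [dissipation]
  ring

/-- The expected energy decays exponentially, at a rate that is polynomial in the size of the
graph. -/
lemma sum_patternWeight_mul_energy_le (hG : G.Connected) (hΔ : 1 ≤ G.maxDegree) {h : ℝ}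
    (hh : 0 ≤ h) (hh1 : Fintype.card V * h ≤ 1 / 2) (m : ℕ) (f : V → ℝ) :
    ∑ σ : Fin m → Option V,
        patternWeight h σ * energy G (ringUpdates (simpleRandomWalk G) m σ f)
      ≤ (1 - h / (4 * Fintype.card V ^ 2 * G.maxDegree)) ^ m * energy G f := by
  have := hG.nonempty
  have hn : (1 : ℝ) ≤ Fintype.card V := by exact_mod_cast Fintype.card_pos
  have hΔ' : (1 : ℝ) ≤ G.maxDegree := by exact_mod_cast hΔ
  set n : ℝ := ((Fintype.card V : ℕ) : ℝ)
  have hpos : 1 ≤ n ^ 2 * G.maxDegree := one_le_mul_of_one_le_of_one_le (one_le_pow₀ hn) hΔ'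
  have key := sum_patternWeight_mul_le (K := simpleRandomWalk G) (I := fun _ => True)
    (fun _ _ _ => trivial) hh (φ := energy G) (ψ := fun _ => 0)
    (κ := h / (4 * n ^ 2 * G.maxDegree)) (e := 0) (by positivity)
    (by rw [div_le_one (by positivity)]; nlinarith) le_rfl ?_ (by simp) m f trivial
  · simpa using key
  · intro f _
    have hE := energy_nonneg G f
    have hB : energy G f / (2 * n ^ 2 * G.maxDegree) ≤ dissipation G f := by
      rw [div_le_iff₀ (by positivity)]
      linarith [energy_le_dissipation hG f]
    rw [sum_ringWeight_mul_energy]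
    calc Real.exp (-(n * h)) * ((1 + n * h) * energy G f - h * dissipation G f)
        ≤ Real.exp (-(n * h)) * ((1 + n * h) * energy G f
          - h * (energy G f / (2 * n ^ 2 * G.maxDegree))) := by gcongr
      _ = Real.exp (-(n * h)) * (1 + n * h - h / (2 * n ^ 2 * G.maxDegree)) * energy G f := by
          ring
      _ ≤ (1 - h / (2 * n ^ 2 * G.maxDegree) / 2) * energy G f :=
          mul_le_mul_of_nonneg_right (exp_neg_mul_one_add_sub_le hh1 (by positivity)) hE
      _ = _ := by field_simp; ring

/-- An exponential supermartingale for the energy and the mass. -/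
lemma sum_ringWeight_mul_exp_le (hd : ∀ v, 0 < G.degree v) {h θ : ℝ} (hh : 0 ≤ h)
    (hh1 : Fintype.card V * h ≤ 1 / 2) (hθ : 0 ≤ θ) (hθ1 : 8 * G.maxDegree * θ ≤ 1) {f : V → ℝ}
    (hf : ∀ v, f v ∈ Set.Icc (0 : ℝ) 1) :
    ∑ o, ringWeight h o * Real.exp (θ * (energy G (ringUpdate (simpleRandomWalk G) o f)
        + mass G (ringUpdate (simpleRandomWalk G) o f)))
      ≤ (1 - h * θ / 4 * dissipation G f) * Real.exp (θ * (energy G f + mass G f)) := by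
  set Δ : ℝ := ((G.maxDegree : ℕ) : ℝ)
  set n : ℝ := ((Fintype.card V : ℕ) : ℝ)
  set t := defect G f
  have hstep : ∀ v, Real.exp (θ * (energy G (ringUpdate (simpleRandomWalk G) (some v) f)
        + mass G (ringUpdate (simpleRandomWalk G) (some v) f)))
      ≤ Real.exp (θ * (energy G f + mass G f))
        * (1 - θ / 2 * (G.degree v * t v ^ 2) - θ * (G.degree v * t v)) := by
    intro v
    have hdv : (G.degree v : ℝ) ≤ Δ := Nat.cast_le.2 (G.degree_le_maxDegree v)
    have hd0 : (0 : ℝ) ≤ G.degree v := Nat.cast_nonneg _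
    have ha : ringUpdate (simpleRandomWalk G) (some v) f v ∈ Set.Icc (0 : ℝ) 1 :=
      ⟨ringUpdate_nonneg (G := G) (some v) (fun v => (hf v).1) v,
        ringUpdate_le hd (some v) (fun v => (hf v).2) v⟩
    have ht : t v = f v - ringUpdate (simpleRandomWalk G) (some v) f v := by
      simp [t, defect, ringUpdate_some]
    have ht1 : |t v| ≤ 1 := by
      rw [ht, abs_le]; constructor <;> linarith [ha.1, ha.2, (hf v).1, (hf v).2]
    have ht2 : t v ^ 2 ≤ 1 := (sq_le_one_iff_abs_le_one _).2 ht1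
    set b := (G.degree v : ℝ) * t v ^ 2
    set w := (G.degree v : ℝ) * t v
    have hb0 : 0 ≤ b := by positivity
    have hb : b ≤ Δ := by nlinarith
    have hw : |w| ≤ Δ := by
      rw [abs_mul, abs_of_nonneg hd0]; nlinarith [abs_nonneg (t v)]
    -- The squared change of mass is at most Δ times the energy drop b; this is why adding the
    -- energy compensates the second-order term of the exponential.
    have hw2 : w ^ 2 ≤ Δ * b := by
      have : w ^ 2 = G.degree v * b := by ring
      rw [this]; gcongr
    rw [energy_ringUpdate, mass_ringUpdate]
    have hx : θ * (energy G f - b + (mass G f - w))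
        = θ * (energy G f + mass G f) + (-(θ * (b + w))) := by ring
    rw [hx, Real.exp_add]
    refine mul_le_mul_of_nonneg_left ?_ (Real.exp_pos _).le
    have habs : |(-(θ * (b + w)))| ≤ 1 := by
      rw [abs_neg, abs_mul, abs_of_nonneg hθ]
      have : |b + w| ≤ 2 * Δ := (abs_add_le b w).trans (by rw [abs_of_nonneg hb0]; linarith)
      nlinarith [abs_nonneg (b + w)]
    have h1 := (abs_le.1 (Real.abs_exp_sub_one_sub_id_le habs)).2
    have h2 : (-(θ * (b + w))) ^ 2 ≤ θ / 2 * b := by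
      have h3 : (b + w) ^ 2 ≤ 4 * Δ * b := by nlinarith [sq_nonneg (b - w)]
      have h4 : θ * (4 * Δ * θ * b) ≤ θ * (b / 2) := by
        refine mul_le_mul_of_nonneg_left ?_ hθ
        nlinarith
      nlinarith [mul_le_mul_of_nonneg_left h3 (sq_nonneg θ)]
    linarith
  have hsum : ∑ v, Real.exp (θ * (energy G (ringUpdate (simpleRandomWalk G) (some v) f)
        + mass G (ringUpdate (simpleRandomWalk G) (some v) f)))
      ≤ Real.exp (θ * (energy G f + mass G f)) * (n - θ / 2 * dissipation G f) := by
    -- The terms linear in the mass change cancel in the sum over v.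
    refine (Finset.sum_le_sum fun v _ => hstep v).trans_eq ?_
    rw [← Finset.mul_sum, Finset.sum_sub_distrib, Finset.sum_sub_distrib, ← Finset.mul_sum,
      ← Finset.mul_sum, sum_degree_mul_defect]
    simp [dissipation, n, t]
  simp only [Fintype.sum_option, ringWeight, ringUpdate_none, ← Finset.mul_sum]
  set E := Real.exp (θ * (energy G f + mass G f))
  have hE : 0 < E := Real.exp_pos _
  have hB := dissipation_nonneg G f
  calc _ ≤ Real.exp (-(n * h)) * E
        + h * Real.exp (-(n * h)) * (E * (n - θ / 2 * dissipation G f)) := by gcongr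
    _ = Real.exp (-(n * h)) * (1 + n * h - h * θ / 2 * dissipation G f) * E := by ring
    _ ≤ (1 - h * θ / 2 * dissipation G f / 2) * E :=
        mul_le_mul_of_nonneg_right (exp_neg_mul_one_add_sub_le hh1 (by positivity)) hE.le
    _ = _ := by ring

/-- The set {f ≥ δ/2} has at most 2L/δ < n vertices, so it misses one, and a path from the maximum
to that vertex gives E ≥ δ³/(16L). Since 0 ≤ f ≤ 1, Σ deg·f² ≤ L, hence E² ≤ L·dissipation. -/
lemma le_dissipation (hG : G.Connected) (hd : ∀ v, 0 < G.degree v) {f : V → ℝ}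
    (hf : ∀ v, f v ∈ Set.Icc (0 : ℝ) 1) {δ L : ℝ} (hδ : 0 < δ) (hL : 0 < L)
    (hn : 2 * L / δ < Fintype.card V) (hmax : ∃ v, δ < f v) (hmass : mass G f ≤ L) :
    δ ^ 6 / (256 * L ^ 3) ≤ dissipation G f := by
  obtain ⟨a, ha⟩ := hmax
  set H := Finset.univ.filter fun w => δ / 2 ≤ f w
  have hd1 : ∀ v, (1 : ℝ) ≤ G.degree v := fun v => by exact_mod_cast hd v
  have hcard : (H.card : ℝ) ≤ 2 * L / δ := by
    have h1 : ∑ w ∈ H, δ / 2 ≤ ∑ w ∈ H, (G.degree w : ℝ) * f w :=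
      Finset.sum_le_sum fun w hw => by
        have := (Finset.mem_filter.1 hw).2
        nlinarith [hd1 w]
    have h2 : ∑ w ∈ H, (G.degree w : ℝ) * f w ≤ mass G f :=
      Finset.sum_le_sum_of_subset_of_nonneg (Finset.subset_univ _) fun w _ _ =>
        mul_nonneg (Nat.cast_nonneg _) (hf w).1
    rw [Finset.sum_const, nsmul_eq_mul] at h1
    rw [le_div_iff₀ hδ]
    linarith
  obtain ⟨b, hb⟩ : ∃ b, b ∉ H := by
    by_contra! hcon
    have : H = Finset.univ := Finset.eq_univ_iff_forall.2 hcon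
    rw [this, Finset.card_univ] at hcard
    linarith
  have hE := energy_nonneg G f
  have hB := dissipation_nonneg G f
  have h1 := sq_sub_le_card_mul_energy hG f (δ / 2) (a := a) (b := b) (by linarith)
    (by simp [H] at hb; exact hb.le)
  have h2 : (δ / 2) ^ 2 ≤ 2 * L / δ * (2 * energy G f) := by
    refine le_trans ?_ (h1.trans (mul_le_mul_of_nonneg_right hcard (by positivity)))
    exact pow_le_pow_left₀ (by positivity) (by linarith) 2
  have h3 : δ ^ 3 / (16 * L) ≤ energy G f := by
    rw [div_le_iff₀ (by positivity)]
    have : 2 * L / δ * (2 * energy G f) = 4 * L * energy G f / δ := by ring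
    rw [this, le_div_iff₀ hδ] at h2
    nlinarith
  have h4 : energy G f ^ 2 ≤ L * dissipation G f := by
    refine (energy_sq_le G f 0).trans (mul_le_mul_of_nonneg_right (le_trans ?_ hmass) hB)
    refine Finset.sum_le_sum fun v _ => mul_le_mul_of_nonneg_left ?_ (Nat.cast_nonneg _)
    nlinarith [(hf v).1, (hf v).2]
  have h5 : (δ ^ 3 / (16 * L)) ^ 2 ≤ L * dissipation G f :=
    (pow_le_pow_left₀ (by positivity) h3 2).trans h4
  rw [div_le_iff₀ (by positivity)]
  rw [div_pow, div_le_iff₀ (by positivity)] at h5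
  nlinarith

lemma energy_single (u : V) : energy G (Pi.single u 1) = G.degree u := by
  simp [energy, SimpleGraph.lapMatrix, SimpleGraph.degMatrix]

lemma mass_single (u : V) : mass G (Pi.single u 1) = G.degree u := by
  simp [mass, Pi.single_apply]

/-- The dynamics started from the indicator function of a vertex becomes uniformly small. -/
lemma sum_patternWeight_single_gt_le (hG : G.Connected) (hd : ∀ v, 0 < G.degree v)
    {h δ L : ℝ} (hh : 0 ≤ h) (hh1 : Fintype.card V * h ≤ 1 / 2) (hδ : 0 < δ) (hδ1 : δ ≤ 1)
    (hL : 1 ≤ L) (hn : 2 * L / δ < Fintype.card V) (m : ℕ) (u : V) :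
    ∑ σ : Fin m → Option V, patternWeight h σ *
        (if ∃ v, δ < ringUpdates (simpleRandomWalk G) m σ (Pi.single u 1) v then 1 else 0)
      ≤ 2 * (1 - h * (δ ^ 6 / (16384 * G.maxDegree * L ^ 3))) ^ m
        + 2 * Real.exp (-(L / (16 * G.maxDegree))) := by
  have hΔ : (1 : ℝ) ≤ G.maxDegree := by
    exact_mod_cast (hd u).trans_le (G.degree_le_maxDegree u)
  have hcard : (1 : ℝ) ≤ Fintype.card V := by exact_mod_cast Fintype.card_pos_iff.2 ⟨u⟩
  set Δ : ℝ := ((G.maxDegree : ℕ) : ℝ)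
  -- Chosen so that the supermartingale bound still applies at 2θ; an indicator has E + M ≤ 2Δ, so
  -- both exponentials start below exp(1/4) ≤ 2.
  set θ : ℝ := 1 / (16 * Δ)
  have hθ : 0 < θ := by positivity
  have hθΔ : θ * Δ = 1 / 16 := by simp only [θ]; field_simp
  set κ : ℝ := h * (δ ^ 6 / (16384 * Δ * L ^ 3))
  have hκ0 : 0 ≤ κ := by positivity
  have hκ1 : κ ≤ 1 := by
    have h1 : δ ^ 6 / (16384 * Δ * L ^ 3) ≤ 1 := by
      rw [div_le_one (by positivity)]
      have : 1 ≤ Δ * L ^ 3 := one_le_mul_of_one_le_of_one_le hΔ (one_le_pow₀ hL)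
      have : δ ^ 6 ≤ 1 := pow_le_one₀ hδ.le hδ1
      nlinarith
    have h2 : h ≤ 1 := by nlinarith
    exact mul_le_one₀ h2 (by positivity) h1
  set Ψ : ℝ → (V → ℝ) → ℝ := fun θ f => Real.exp (θ * (energy G f + mass G f))
  set φ : (V → ℝ) → ℝ := fun f => if ∃ v, δ < f v then Ψ θ f else 0
  set I : (V → ℝ) → Prop := fun f => ∀ v, f v ∈ Set.Icc (0 : ℝ) 1
  have hI : ∀ o f, I f → I (ringUpdate (simpleRandomWalk G) o f) := fun o f hf v =>
    ⟨ringUpdate_nonneg (G := G) o (fun v => (hf v).1) v, ringUpdate_le hd o (fun v => (hf v).2) v⟩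
  have hu : I (Pi.single u 1) := fun v => by
    by_cases h : v = u
    · subst h; simp
    · simp [h]
  have hsuper : ∀ f, I f → ∑ o, ringWeight h o * Ψ (2 * θ) (ringUpdate (simpleRandomWalk G) o f)
      ≤ Ψ (2 * θ) f := by
    intro f hf
    refine (sum_ringWeight_mul_exp_le hd hh hh1 (θ := 2 * θ) (by positivity) (by linarith)
      hf).trans ?_
    have := dissipation_nonneg G f
    refine mul_le_of_le_one_left (Real.exp_pos _).le ?_
    have : 0 ≤ h * (2 * θ) / 4 * dissipation G f := by positivity
    linarith
  have hφ : ∀ f, I f → ∑ o, ringWeight h o * φ (ringUpdate (simpleRandomWalk G) o f)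
      ≤ (1 - κ) * φ f + κ * Real.exp (-(θ * L)) * Ψ (2 * θ) f := by
    intro f hf
    by_cases hmax : ∃ v, δ < f v
    · have h1 : ∑ o, ringWeight h o * φ (ringUpdate (simpleRandomWalk G) o f)
          ≤ ∑ o, ringWeight h o * Ψ θ (ringUpdate (simpleRandomWalk G) o f) := by
        refine Finset.sum_le_sum fun o _ => mul_le_mul_of_nonneg_left ?_ (ringWeight_nonneg hh o)
        simp only [φ]
        split_ifs
        · exact le_rfl
        · exact (Real.exp_pos _).le
      have h2 := h1.trans (sum_ringWeight_mul_exp_le hd hh hh1 hθ.le (by linarith) hf)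
      have hΨ : 0 < Ψ θ f := Real.exp_pos _
      have hB := dissipation_nonneg G f
      have hφf : φ f = Ψ θ f := if_pos hmax
      rw [hφf]
      by_cases hmass : mass G f ≤ L
      · have h3 := le_dissipation hG hd hf hδ (by linarith) hn hmax hmass
        have h4 : κ ≤ h * θ / 4 * dissipation G f := by
          calc κ = h * θ / 4 * (δ ^ 6 / (256 * L ^ 3)) := by simp only [κ, θ]; field_simp; ring
            _ ≤ _ := by gcongr
        have h5 : 0 ≤ κ * Real.exp (-(θ * L)) * Ψ (2 * θ) f := by positivity
        refine h2.trans ?_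
        have : (1 - h * θ / 4 * dissipation G f) * Ψ θ f ≤ (1 - κ) * Ψ θ f := by gcongr
        linarith
      -- Above mass L decay may fail, but there Ψ θ ≤ e^{-θL}·Ψ (2θ), which is absorbed by the error
      -- term.
      · push Not at hmass
        have h3 : Ψ θ f ≤ Real.exp (-(θ * L)) * Ψ (2 * θ) f := by
          simp only [Ψ]
          rw [← Real.exp_add]
          apply Real.exp_le_exp.2
          have := energy_nonneg G f
          nlinarith
        have h4 : (1 - h * θ / 4 * dissipation G f) * Ψ θ f ≤ Ψ θ f := by
          refine mul_le_of_le_one_left hΨ.le ?_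
          have : 0 ≤ h * θ / 4 * dissipation G f := by positivity
          linarith
        have := mul_le_mul_of_nonneg_left h3 hκ0
        exact h2.trans (h4.trans (by linarith))
    · have hmax' : ∀ v, f v ≤ δ := by simpa using hmax
      have h1 : ∀ o, φ (ringUpdate (simpleRandomWalk G) o f) = 0 := fun o =>
        if_neg (by simpa using ringUpdate_le hd o hmax')
      have h2 : φ f = 0 := if_neg hmax
      simp only [h1, h2, mul_zero, Finset.sum_const_zero, zero_add]
      positivity
  have key := sum_patternWeight_mul_le hI hh hκ0 hκ1 (Real.exp_pos _).le hφ hsuper m _ hu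
  have hdeg : (G.degree u : ℝ) ≤ Δ := Nat.cast_le.2 (G.degree_le_maxDegree u)
  have hexp : Real.exp (1 / 4) ≤ 2 := by
    have := Real.exp_bound' (x := 1 / 4) (by norm_num) (by norm_num) (n := 2) (by norm_num)
    refine this.trans ?_
    norm_num [Finset.sum_range_succ, Nat.factorial]
  have hΨ2 : Ψ (2 * θ) (Pi.single u 1) ≤ 2 := by
    refine le_trans (Real.exp_le_exp.2 ?_) hexp
    rw [energy_single, mass_single]
    nlinarith
  have hΨ1 : φ (Pi.single u 1) ≤ 2 := by
    simp only [φ]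
    split_ifs
    · refine le_trans (Real.exp_le_exp.2 ?_) hexp
      rw [energy_single, mass_single]
      nlinarith
    · norm_num
  have hpow0 : 0 ≤ (1 - κ) ^ m := pow_nonneg (by linarith) m
  have hE0 := Real.exp_pos (-(θ * L))
  calc _ ≤ ∑ σ : Fin m → Option V, patternWeight h σ *
          φ (ringUpdates (simpleRandomWalk G) m σ (Pi.single u 1)) := by
        refine Finset.sum_le_sum fun σ _ => mul_le_mul_of_nonneg_left ?_ (patternWeight_nonneg hh σ)
        have hσ := ringUpdates_induction _ I hI m σ _ hu
        simp only [φ]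
        split_ifs
        · refine Real.one_le_exp (mul_nonneg hθ.le (add_nonneg (energy_nonneg _ _) ?_))
          exact mass_nonneg fun v => (hσ v).1
        · exact le_rfl
    _ ≤ _ := key
    _ ≤ (1 - κ) ^ m * 2 + Real.exp (-(θ * L)) * 2 := by
        refine add_le_add (mul_le_mul_of_nonneg_left hΨ1 hpow0) ?_
        have : Real.exp (-(θ * L)) * (1 - (1 - κ) ^ m) ≤ Real.exp (-(θ * L)) :=
          mul_le_of_le_one_right hE0.le (by linarith)
        exact mul_le_mul this hΨ2 (Real.exp_pos _).le hE0.le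
    _ = _ := by
        have : θ * L = L / (16 * Δ) := by simp only [θ]; ring
        rw [this]; ring

end Drift

/-! ### Trajectories between two slot endpoints -/

section Path

variable {V : Type*} [Fintype V] [DecidableEq V]

/-- A monotone right-continuous counting function that increases by one on `[s, t]` jumps at a
single time. -/
lemma exists_jump {N : ℝ≥0 → ℕ} (hmono : Monotone N)
    (hcont : ∀ t, ContinuousWithinAt N (Set.Ici t) t) {s t : ℝ≥0} (hst : s ≤ t)
    (h : N t = N s + 1) :
    ∃ r, s < r ∧ r ≤ t ∧ N r = N t ∧ ∀ x, s ≤ x → x < r → N x = N s := by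
  set S : Set ℝ≥0 := {x | s ≤ x ∧ N s + 1 ≤ N x}
  have hne : S.Nonempty := ⟨t, hst, h.ge⟩
  have hbdd : BddBelow S := OrderBot.bddBelow S
  have hglb : IsGLB S (sInf S) := isGLB_csInf hne hbdd
  set r := sInf S
  have hsr : s ≤ r := le_csInf hne fun x hx => hx.1
  have hrt : r ≤ t := csInf_le hbdd ⟨hst, h.ge⟩
  -- A right-continuous integer-valued function is constant just after r, so the infimum r itself
  -- already carries the jump.
  have hev : ∀ᶠ x in 𝓝[≥] r, N x = N r :=
    (hcont r).tendsto.eventually ((isOpen_discrete {N r}).mem_nhds rfl)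
  obtain ⟨x, hx, hxr⟩ := ((hglb.frequently_mem hne).and_eventually hev).exists
  have hr : N s + 1 ≤ N r := hxr ▸ hx.2
  refine ⟨r, lt_of_le_of_ne hsr ?_, hrt, ?_, ?_⟩
  · intro heq
    rw [← heq] at hr
    omega
  · have := hmono hrt
    omega
  · intro y hsy hyr
    have h1 := hmono hsy
    by_contra hne'
    have : y ∈ S := ⟨hsy, by omega⟩
    exact absurd (csInf_le hbdd this) (not_le.2 hyr)

/-- Before the unique jump in the slot every opinion is frozen, so the left limits in the update
rule are the opinions at time s. -/
lemma IsDeGrootPath.eq_ringUpdate {K : Matrix V V ℝ} {N : V → ℝ≥0 → ℕ} {f : ℝ≥0 → V → ℝ}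
    (hf : IsDeGrootPath K N f) (hmono : ∀ v, Monotone (N v))
    (hcont : ∀ v t, ContinuousWithinAt (N v) (Set.Ici t) t) {s t : ℝ≥0} (hst : s ≤ t)
    {o : Option V} (ho : ∀ u, N u t - N u s = if o = some u then 1 else 0) :
    f t = ringUpdate K o (f s) := by
  have hconst : ∀ u, o ≠ some u → ∀ x, s ≤ x → x ≤ t → f x u = f s u := by
    intro u hu x hsx hxt
    have h1 := ho u
    rw [if_neg hu] at h1
    have h2 := hmono u hsx
    have h3 := hmono u hxt
    exact hf.constant u s x hsx (by omega)
  cases o with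
  | none => ext u; exact hconst u (by simp) t hst le_rfl
  | some v =>
    have h1 := ho v
    rw [if_pos rfl] at h1
    obtain ⟨r, hsr, hrt, hNr, hbefore⟩ := exists_jump (hmono v) (hcont v) hst (by omega)
    have hring : RingsAt (N v) r := by
      refine ⟨bot_le.trans_lt hsr, fun x hx => ?_⟩
      have : N v x ≤ N v s := by
        rcases le_total x s with h | h
        · exact hmono v h
        · exact (hbefore x h hx).le
      omega
    obtain ⟨g, hg, hfr⟩ := hf.update v r hring
    have hfs : ∀ u x, s ≤ x → x < r → f x u = f s u := by
      intro u x hsx hxr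
      by_cases hu : u = v
      · subst hu; exact hf.constant u s x hsx (hbefore x hsx hxr).symm
      · exact hconst u (by simpa using Ne.symm hu) x hsx (hxr.le.trans hrt)
    have hgs : ∀ u, g u = f s u := by
      intro u
      have : (𝓝[<] r).NeBot := nhdsLT_neBot_of_exists_lt ⟨s, hsr⟩
      refine tendsto_nhds_unique (hg u) (tendsto_const_nhds.congr' ?_)
      filter_upwards [Ioo_mem_nhdsLT hsr] with x hx
      exact (hfs u x hx.1.le hx.2).symm
    ext u
    rw [ringUpdate_some]
    by_cases hu : u = v
    · subst hu
      simp only [Function.update_self]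
      rw [hf.constant u r t hrt hNr, hfr]
      simp_rw [hgs]
    · simp only [ne_eq, hu, not_false_eq_true, Function.update_of_ne]
      exact hconst u (by simpa using Ne.symm hu) t hst le_rfl

end Path

/-! ### From Poisson clocks to ring patterns -/

section Coupling

variable {V Ω : Type*} [DecidableEq V] [MeasurableSpace Ω]

/-- The counting functions whose increments over the first `m` intervals of length `h` show the
rings listed by `σ`. -/
def patternSet (h : ℝ≥0) {m : ℕ} (σ : Fin m → Option V) : Set (V → ℝ≥0 → ℕ) :=
  {n | ∀ u (k : Fin m), n u (((k : ℕ) + 1 : ℕ) * h) - n u ((k : ℕ) * h)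
    = if σ k = some u then 1 else 0}

lemma disjoint_patternSet (h : ℝ≥0) {m : ℕ} :
    Pairwise (Function.onFun Disjoint (patternSet h : (Fin m → Option V) → _)) := by
  intro σ τ hne
  refine Set.disjoint_left.2 fun n hσ hτ => hne ?_
  ext1 k
  refine Option.ext fun u => ?_
  have h1 := (hσ u k).symm.trans (hτ u k)
  by_cases h2 : σ k = some u <;> by_cases h3 : τ k = some u <;> simp_all

variable [Fintype V]

lemma measurableSet_patternSet (h : ℝ≥0) {m : ℕ} (σ : Fin m → Option V) :
    MeasurableSet (patternSet h σ) := by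
  simp only [patternSet, Set.ofPred_forall]
  refine MeasurableSet.iInter fun u => MeasurableSet.iInter fun k => ?_
  refine measurableSet_eq_fun ?_ measurable_const
  exact Measurable.sub ((measurable_pi_apply _).comp (measurable_pi_apply u))
    ((measurable_pi_apply _).comp (measurable_pi_apply u))

lemma prod_poissonMeasure (h : ℝ≥0) (o : Option V) :
    ∏ u, (poissonMeasure h).real {if o = some u then 1 else 0} = ringWeight h o := by
  have h1 : ∀ u, (poissonMeasure h).real {if o = some u then 1 else 0}
      = Real.exp (-h) * if o = some u then (h : ℝ) else 1 := by
    intro u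
    rw [poissonMeasure_real_singleton]
    split_ifs <;> simp
  simp_rw [h1]
  rw [Finset.prod_mul_distrib, Finset.prod_const, ← Real.exp_nat_mul, Finset.card_univ]
  cases o with
  | none => simp [ringWeight]
  | some v => simp [ringWeight, mul_comm]

variable {P : Measure Ω} {K : Matrix V V ℝ}
  {N : V → ℝ≥0 → Ω → ℕ} {f : ℝ≥0 → V → Ω → ℝ}

/-- Independence of the increments of each clock and of the clocks gives a product over vertices and
slots, regrouped by slots. -/
lemma IsDeGrootDynamics.measureReal_patternSet (hD : IsDeGrootDynamics K N f P) (h : ℝ≥0) {m : ℕ}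
    (σ : Fin m → Option V) :
    P.real ((fun ω v t => N v t ω) ⁻¹' patternSet h σ) = patternWeight h σ := by
  have hincr : ∀ u, P (⋂ k : Fin m, {ω | N u (((k : ℕ) + 1 : ℕ) * h) ω - N u ((k : ℕ) * h) ω
      = if σ k = some u then 1 else 0})
      = ∏ k, poissonMeasure h {if σ k = some u then 1 else 0} := by
    intro u
    have hind := (hD.clock u).indepIncrements m (fun k => ((k : ℕ) : ℝ≥0) * h)
      (fun i j hij => by
        have : ((i : ℕ) : ℝ≥0) ≤ (j : ℕ) := by exact_mod_cast hij
        simp only; gcongr)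
    have h1 := hind.meas_iInter (s := fun k : Fin m => {ω | N u (((k : ℕ) + 1 : ℕ) * h) ω
      - N u ((k : ℕ) * h) ω = if σ k = some u then 1 else 0})
      (fun k => ⟨{if σ k = some u then 1 else 0}, measurableSet_singleton _, by ext ω; simp⟩)
    rw [h1]
    refine Finset.prod_congr rfl fun k _ => ?_
    have hle : ((k : ℕ) : ℝ≥0) * h ≤ (((k : ℕ) + 1 : ℕ) : ℝ≥0) * h := by gcongr; simp
    have h2 := ((hD.clock u).law _ _ hle).measure_eq
      (p := fun x => x = if σ k = some u then 1 else 0) (measurableSet_singleton _)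
    rw [h2]
    have h3 : (((k : ℕ) + 1 : ℕ) : ℝ≥0) * h - ((k : ℕ) : ℝ≥0) * h = h := by
      push_cast; rw [add_mul, one_mul, add_tsub_cancel_left]
    rw [h3]; rfl
  have h1 := hD.iIndep_clock.meas_iInter (s := fun u => ⋂ k : Fin m,
      {ω | N u (((k : ℕ) + 1 : ℕ) * h) ω - N u ((k : ℕ) * h) ω = if σ k = some u then 1 else 0})
    (fun u => ⟨{n | ∀ k : Fin m, n (((k : ℕ) + 1 : ℕ) * h) - n ((k : ℕ) * h)
        = if σ k = some u then 1 else 0}, by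
      simp only [Set.ofPred_forall]
      refine MeasurableSet.iInter fun k => measurableSet_eq_fun ?_ measurable_const
      exact (measurable_pi_apply _).sub (measurable_pi_apply _), by ext ω; simp⟩)
  have h2 : (fun ω v t => N v t ω) ⁻¹' patternSet h σ = ⋂ u, ⋂ k : Fin m,
      {ω | N u (((k : ℕ) + 1 : ℕ) * h) ω - N u ((k : ℕ) * h) ω
        = if σ k = some u then 1 else 0} := by
    ext ω; simp [patternSet]
  rw [h2, measureReal_def, h1, ENNReal.toReal_prod]
  simp_rw [hincr, ENNReal.toReal_prod]
  rw [Finset.prod_comm]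
  exact Finset.prod_congr rfl fun k _ => prod_poissonMeasure h (σ k)

variable [IsProbabilityMeasure P]

/-- Up to the probability of two rings in the same interval of length `h`, the law of the opinions
at time `m * h` is a mixture over the possible patterns of rings. -/
lemma IsDeGrootDynamics.measureReal_le (hD : IsDeGrootDynamics K N f P) (h : ℝ≥0) (m : ℕ)
    {S : Set (V → ℝ)} (hS : MeasurableSet S) :
    P.real {ω | (fun v => f (m * h) v ω) ∈ S}
      ≤ ∑ σ : Fin m → Option V, patternWeight h σ
          * P.real {ω | ringUpdates K m σ (fun v => f 0 v ω) ∈ S}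
        + (1 - ∑ σ : Fin m → Option V, patternWeight (V := V) h σ) := by
  set c : Ω → V → ℝ≥0 → ℕ := fun ω v t => N v t ω
  have hc : Measurable c :=
    measurable_pi_lambda _ fun v => measurable_pi_lambda _ fun t => (hD.clock v).measurable t
  set E : (Fin m → Option V) → Set Ω := fun σ => c ⁻¹' patternSet h σ
  set F : (Fin m → Option V) → Set Ω := fun σ => {ω | ringUpdates K m σ (fun v => f 0 v ω) ∈ S}
  have hE : ∀ σ, MeasurableSet (E σ) := fun σ => hc (measurableSet_patternSet h σ)
  have hpath : ∀ᵐ ω ∂P, ω ∈ {ω | (fun v => f (m * h) v ω) ∈ S} →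
      ω ∈ (⋃ σ, E σ ∩ F σ) ∪ (⋃ σ, E σ)ᶜ := by
    filter_upwards [hD.path, ae_all_iff.2 fun v => (hD.clock v).mono,
      ae_all_iff.2 fun v => (hD.clock v).rightCont] with ω hω hmono hcont hSω
    by_cases hσ : ω ∈ ⋃ σ, E σ
    · left
      obtain ⟨σ, hσ⟩ := Set.mem_iUnion.1 hσ
      refine Set.mem_iUnion.2 ⟨σ, hσ, ?_⟩
      have h1 := ringUpdates_eq_of_forall K m σ (fun k v => f (k * h) v ω) fun k =>
        hω.eq_ringUpdate hmono hcont (s := (k : ℕ) * h) (t := ((k : ℕ) + 1 : ℕ) * h)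
          (by gcongr; simp) (fun u => hσ u k)
      simp only [Nat.cast_zero, zero_mul] at h1
      simp only [F, Set.mem_ofPred_eq, ← h1]
      exact hSω
    · exact Or.inr hσ
  have hEF : ∀ σ, P.real (E σ ∩ F σ) = patternWeight h σ * P.real (F σ) := by
    intro σ
    have hmeas : MeasurableSet {x : V → ℝ | ringUpdates K m σ x ∈ S} :=
      (LinearMap.continuous_of_finiteDimensional (ringUpdates K m σ)).measurable hS
    have h1 := hD.indep_init.symm.measure_inter_preimage_eq_mul _ _
      (measurableSet_patternSet h σ) hmeas
    rw [← hD.measureReal_patternSet h σ]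
    simp only [measureReal_def, ← ENNReal.toReal_mul]
    exact congrArg ENNReal.toReal h1
  have hU : P.real (⋃ σ, E σ) = ∑ σ : Fin m → Option V, patternWeight h σ := by
    rw [measureReal_iUnion_fintype
      (fun σ τ hne => (disjoint_patternSet h hne).preimage c) hE]
    exact Finset.sum_congr rfl fun σ _ => hD.measureReal_patternSet h σ
  calc P.real {ω | (fun v => f (m * h) v ω) ∈ S}
      ≤ P.real ((⋃ σ, E σ ∩ F σ) ∪ (⋃ σ, E σ)ᶜ) :=
        ENNReal.toReal_mono (measure_ne_top _ _) (measure_mono_ae hpath)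
    _ ≤ P.real (⋃ σ, E σ ∩ F σ) + P.real (⋃ σ, E σ)ᶜ := measureReal_union_le _ _
    _ ≤ ∑ σ, P.real (E σ ∩ F σ) + (1 - P.real (⋃ σ, E σ)) := by
        refine add_le_add (measureReal_iUnion_fintype_le _) ?_
        rw [probReal_compl_eq_one_sub (MeasurableSet.iUnion hE)]
    _ = _ := by rw [hU]; simp_rw [hEF]; rfl

end Coupling

/-! ### Concentration of weighted sums -/

section Hoeffding

variable {V Ω : Type*} [Fintype V] [MeasurableSpace Ω] {P : Measure Ω} [IsProbabilityMeasure P]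

lemma measureReal_sum_mul_sub_ge_le {X : V → Ω → ℝ} (hind : iIndepFun X P)
    (hm : ∀ v, AEMeasurable (X v) P) (hb : ∀ v, ∀ᵐ ω ∂P, X v ω ∈ Set.Icc (0 : ℝ) 1)
    (a : V → ℝ) {δ s : ℝ} (ha0 : a ≠ 0) (ha : ∑ u, a u ^ 2 ≤ δ) (hs : 0 ≤ s) :
    P.real {ω | s ≤ ∑ u, a u * (X u ω - P[X u])} ≤ Real.exp (-(2 * s ^ 2 / δ)) := by
  have h1 : ∀ u ∈ Finset.univ, HasSubgaussianMGF (fun ω => a u * (X u ω - P[X u]))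
      (.mk (a u ^ 2) (sq_nonneg _) * (‖(1 : ℝ) - 0‖₊ / 2) ^ 2) P := fun u _ =>
    (hasSubgaussianMGF_of_mem_Icc (hm u) (hb u)).const_mul (a u)
  have h2 : iIndepFun (fun u ω => a u * (X u ω - P[X u])) P :=
    hind.comp (fun u x => a u * (x - ∫ ω, X u ω ∂P)) fun u => by fun_prop
  refine (HasSubgaussianMGF.measure_sum_ge_le_of_iIndepFun h2 h1 hs).trans ?_
  obtain ⟨v, hv⟩ := Function.ne_iff.1 ha0
  -- Replacing the variance by its upper bound δ needs a positive variance, since division by zero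
  -- would yield the trivial bound 1.
  have hpos : 0 < ∑ u, a u ^ 2 := by
    refine Finset.sum_pos' (fun u _ => sq_nonneg _) ⟨v, Finset.mem_univ v, ?_⟩
    exact sq_pos_of_ne_zero hv
  have h3 : (2 * ∑ u, ((.mk (a u ^ 2) (sq_nonneg _) * (‖(1 : ℝ) - 0‖₊ / 2) ^ 2 : ℝ≥0) : ℝ))
      = (∑ u, a u ^ 2) / 2 := by
    push_cast
    rw [← Finset.sum_mul]
    norm_num
    ring
  push_cast at h3 ⊢
  rw [h3]
  apply Real.exp_le_exp.2
  rw [neg_div, neg_le_neg_iff, div_div_eq_mul_div, mul_comm]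
  gcongr

end Hoeffding

/-! ### Oscillation and consensus time -/

section Oscillation

variable {V : Type*}

/-- The set of functions whose oscillation exceeds `ε`. -/
def largeOsc (V : Type*) (ε : ℝ) : Set (V → ℝ) := {x | ∃ v w, ε < x v - x w}

lemma osc_le_of_notMem_largeOsc [Nonempty V] {ε : ℝ} {x : V → ℝ} (hx : x ∉ largeOsc V ε) :
    osc x ≤ ε := by
  have h : ∀ v w, x v - x w ≤ ε := by simpa [largeOsc] using hx
  rw [osc, sub_le_iff_le_add]
  refine ciSup_le fun v => ?_
  rw [← sub_le_iff_le_add']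
  exact le_ciInf fun w => by linarith [h v w]

lemma measurableSet_largeOsc [Countable V] (ε : ℝ) : MeasurableSet (largeOsc V ε) := by
  simp only [largeOsc, Set.ofPred_exists]
  refine MeasurableSet.iUnion fun v => MeasurableSet.iUnion fun w => ?_
  exact measurableSet_lt measurable_const ((measurable_pi_apply v).sub (measurable_pi_apply w))

/-- The first integer time of small oscillation equals the number of integer times before it, all of
large oscillation; monotonicity of the oscillation is not needed. -/
lemma consensusTime_le_tsum [Nonempty V] (ε : ℝ) (f : ℝ≥0 → V → ℝ) :
    consensusTime ε f
      ≤ ∑' k : ℕ, {k : ℕ | f k ∈ largeOsc V ε}.indicator (fun _ => (1 : ℝ≥0∞)) k := by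
  classical
  by_cases h : ∃ k : ℕ, f k ∉ largeOsc V ε
  · calc consensusTime ε f ≤ ((Nat.find h : ℕ) : ℝ≥0) :=
          iInf₂_le (α := ℝ≥0∞) ((Nat.find h : ℕ) : ℝ≥0)
            (osc_le_of_notMem_largeOsc (Nat.find_spec h))
      _ = ∑ k ∈ Finset.range (Nat.find h),
          {k : ℕ | f k ∈ largeOsc V ε}.indicator (fun _ => (1 : ℝ≥0∞)) k := by
          rw [Finset.sum_congr rfl fun k hk => Set.indicator_of_mem
            (s := {k : ℕ | f k ∈ largeOsc V ε})
            (not_not.1 (Nat.find_min h (Finset.mem_range.1 hk))) _]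
          simp
      _ ≤ _ := ENNReal.sum_le_tsum _
  · push Not at h
    have h1 : {k : ℕ | f k ∈ largeOsc V ε} = Set.univ := Set.eq_univ_of_forall h
    simp [h1]

lemma lintegral_consensusTime_le [Fintype V] [Nonempty V] {Ω : Type*} [MeasurableSpace Ω]
    {P : Measure Ω} {f : ℝ≥0 → V → Ω → ℝ} (hf : ∀ t v, AEMeasurable (f t v) P) (ε : ℝ) :
    ∫⁻ ω, consensusTime ε (fun t v => f t v ω) ∂P
      ≤ ∑' k : ℕ, P {ω | (fun v => f k v ω) ∈ largeOsc V ε} := by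
  have hB : ∀ k : ℕ, NullMeasurableSet {ω | (fun v => f k v ω) ∈ largeOsc V ε} P := fun k =>
    (aemeasurable_pi_lambda _ (hf k)).nullMeasurableSet_preimage (measurableSet_largeOsc ε)
  calc ∫⁻ ω, consensusTime ε (fun t v => f t v ω) ∂P
      ≤ ∫⁻ ω, ∑' k : ℕ, {ω | (fun v => f k v ω) ∈ largeOsc V ε}.indicator 1 ω ∂P :=
        lintegral_mono fun ω => consensusTime_le_tsum ε _
    _ = ∑' k : ℕ, ∫⁻ ω, {ω | (fun v => f k v ω) ∈ largeOsc V ε}.indicator 1 ω ∂P :=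
        lintegral_tsum fun k => aemeasurable_one.indicator₀ (hB k)
    _ = _ := by simp_rw [lintegral_indicator_one₀ (hB _)]

end Oscillation

/-! ### Disagreement probability at a fixed time -/

section FixedTime

/-- Weights with sum 1 give every vertex the same mean. A large oscillation thus needs a deviation
of ε/2 at some vertex, up or down. -/
lemma measureReal_largeOsc_le_of_forall_le {V Ω : Type*} [Fintype V] [MeasurableSpace Ω]
    {P : Measure Ω} [IsProbabilityMeasure P] {X : V → Ω → ℝ} (hX : IIDInit X P)
    (hm : ∀ v, AEMeasurable (X v) P) (B : (V → ℝ) → V → ℝ) (a : V → V → ℝ) {δ ε : ℝ} (hε : 0 < ε)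
    (hB : ∀ x v, B x v = ∑ u, x u * a u v)
    (ha0 : ∀ u v, 0 ≤ a u v) (ha1 : ∀ v, ∑ u, a u v = 1) (haδ : ∀ u v, a u v ≤ δ) :
    P.real {ω | B (fun v => X v ω) ∈ largeOsc V ε}
      ≤ 2 * Fintype.card V * Real.exp (-(ε ^ 2 / (2 * δ))) := by
  have hne : ∀ v, (fun u => a u v) ≠ 0 := by
    intro v h0
    have := ha1 v
    simp [fun u => congrFun h0 u] at this
  have hsq : ∀ v, ∑ u, a u v ^ 2 ≤ δ := by
    intro v
    calc ∑ u, a u v ^ 2 ≤ ∑ u, δ * a u v := Finset.sum_le_sum fun u _ => by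
          nlinarith [ha0 u v, haδ u v]
      _ = δ := by rw [← Finset.mul_sum, ha1, mul_one]
  have hexp : -(2 * (ε / 2) ^ 2 / δ) = -(ε ^ 2 / (2 * δ)) := by ring
  have hup : ∀ v, P.real {ω | ε / 2 ≤ ∑ u, a u v * (X u ω - P[X u])}
      ≤ Real.exp (-(ε ^ 2 / (2 * δ))) := fun v => hexp ▸
    measureReal_sum_mul_sub_ge_le hX.indep hm hX.mem_Icc (fun u => a u v) (hne v) (hsq v)
      (by positivity)
  have hlow : ∀ v, P.real {ω | ε / 2 ≤ ∑ u, -a u v * (X u ω - P[X u])}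
      ≤ Real.exp (-(ε ^ 2 / (2 * δ))) := fun v => hexp ▸
    measureReal_sum_mul_sub_ge_le hX.indep hm hX.mem_Icc (fun u => -a u v)
      (fun h0 => hne v (funext fun u => by simpa using congrFun h0 u)) (by simpa using hsq v)
      (by positivity)
  have hsub : {ω | B (fun v => X v ω) ∈ largeOsc V ε}
      ⊆ (⋃ v, {ω | ε / 2 ≤ ∑ u, a u v * (X u ω - P[X u])})
        ∪ ⋃ v, {ω | ε / 2 ≤ ∑ u, -a u v * (X u ω - P[X u])} := by
    rintro ω ⟨v, w, hvw⟩
    have hmean : ∀ v', ∑ u, a u v' * (X u ω - P[X u]) = B (fun v => X v ω) v' - P[X v] := by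
      intro v'
      rw [hB]
      simp_rw [fun u => (hX.identDistrib u v).integral_eq, mul_sub]
      rw [Finset.sum_sub_distrib, ← Finset.sum_mul, ha1, one_mul]
      simp_rw [mul_comm]
    by_cases h : ε / 2 ≤ B (fun v => X v ω) v - P[X v]
    · exact Or.inl (Set.mem_iUnion.2 ⟨v, by simpa only [Set.mem_ofPred_eq, hmean v] using h⟩)
    · refine Or.inr (Set.mem_iUnion.2 ⟨w, ?_⟩)
      simp only [Set.mem_ofPred_eq, neg_mul, Finset.sum_neg_distrib, hmean w]
      linarith
  calc P.real {ω | B (fun v => X v ω) ∈ largeOsc V ε}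
      ≤ _ := measureReal_mono hsub
    _ ≤ _ := measureReal_union_le _ _
    _ ≤ (∑ v, P.real {ω | ε / 2 ≤ ∑ u, a u v * (X u ω - P[X u])})
        + ∑ v, P.real {ω | ε / 2 ≤ ∑ u, -a u v * (X u ω - P[X u])} :=
        add_le_add (measureReal_iUnion_fintype_le _) (measureReal_iUnion_fintype_le _)
    _ ≤ ∑ _v : V, Real.exp (-(ε ^ 2 / (2 * δ))) + ∑ _v : V, Real.exp (-(ε ^ 2 / (2 * δ))) :=
        add_le_add (Finset.sum_le_sum fun v _ => hup v) (Finset.sum_le_sum fun v _ => hlow v)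
    _ = _ := by simp; ring

variable {V Ω : Type*} [Fintype V] [DecidableEq V] [MeasurableSpace Ω]
  {P : Measure Ω} [IsProbabilityMeasure P]
  {N : V → ℝ≥0 → Ω → ℕ} {f : ℝ≥0 → V → Ω → ℝ}

lemma IsDeGrootDynamics.measureReal_le_of_forall_pattern {K : Matrix V V ℝ}
    (hD : IsDeGrootDynamics K N f P) (T : ℝ≥0) {S : Set (V → ℝ)} (hS : MeasurableSet S) {C : ℝ}
    (hC : ∀ (m : ℕ) (h : ℝ≥0), m * h = T → (Fintype.card V : ℝ) * h ≤ 1 / 2 →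
      ∑ σ : Fin m → Option V, patternWeight h σ
          * P.real {ω | ringUpdates K m σ (fun v => f 0 v ω) ∈ S} ≤ C) :
    P.real {ω | (fun v => f T v ω) ∈ S} ≤ C := by
  refine le_of_forall_pos_le_add fun η hη => ?_
  set n : ℝ := ((Fintype.card V : ℕ) : ℝ)
  -- The first bound makes n·h ≤ 1/2, the second makes the probability of a slot with two rings at
  -- most η.
  obtain ⟨m, hm⟩ := exists_nat_gt (max (2 * n * T) (n ^ 2 * T ^ 2 / η))
  have hm1 : 2 * n * T < m := (le_max_left _ _).trans_lt hm
  have hm2 : n ^ 2 * T ^ 2 / η < m := (le_max_right _ _).trans_lt hm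
  have hm0 : (0 : ℝ) < m := lt_of_le_of_lt (by positivity) hm1
  have hm0' : (m : ℝ≥0) ≠ 0 := by exact_mod_cast hm0.ne'
  have hmul : (m : ℝ≥0) * (T / m) = T := mul_div_cancel₀ T hm0'
  have hnh : n * ((T / m : ℝ≥0) : ℝ) ≤ 1 / 2 := by
    push_cast
    rw [← mul_div_assoc, div_le_iff₀ hm0]
    linarith
  have h1 := hD.measureReal_le (T / m) m hS
  rw [hmul] at h1
  have h2 := hC m (T / m) hmul hnh
  have h3 := one_sub_le_sum_patternWeight (V := V) (h := (T / m : ℝ≥0)) (NNReal.coe_nonneg _)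
    (hnh.trans (by norm_num)) m
  have h4 : m * (n * ((T / m : ℝ≥0) : ℝ)) ^ 2 ≤ η := by
    push_cast
    have : (m : ℝ) * (n * (T / m)) ^ 2 = n ^ 2 * T ^ 2 / m := by field_simp
    rw [this, div_le_iff₀ hm0]
    rw [div_lt_iff₀ hη] at hm2
    linarith
  linarith

variable {G : SimpleGraph V} [DecidableRel G.Adj]

/-- For opinions in `[0, 1]`, the squared oscillation is controlled by the energies of the dynamics
started from the indicator functions of the vertices. -/
lemma sq_le_sum_energy_of_mem_largeOsc (hG : G.Connected) {K : Matrix V V ℝ} {m : ℕ}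
    (σ : Fin m → Option V) {x : V → ℝ} (hx : ∀ v, x v ∈ Set.Icc (0 : ℝ) 1) {ε : ℝ} (hε : 0 ≤ ε)
    (hosc : ringUpdates K m σ x ∈ largeOsc V ε) :
    ε ^ 2 ≤ 2 * (Fintype.card V : ℝ) ^ 2 * ∑ u, energy G (ringUpdates K m σ (Pi.single u 1)) := by
  obtain ⟨v, w, hvw⟩ := hosc
  set n : ℝ := ((Fintype.card V : ℕ) : ℝ)
  set g : V → V → ℝ := fun u => ringUpdates K m σ (Pi.single u 1)
  have h1 : ringUpdates K m σ x v - ringUpdates K m σ x w = ∑ u, x u * (g u v - g u w) := by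
    rw [ringUpdates_apply_eq_sum, ringUpdates_apply_eq_sum K m σ x w, ← Finset.sum_sub_distrib]
    exact Finset.sum_congr rfl fun u _ => by ring
  have h2 : ∀ (y : V → ℝ) (a b : V), (y a - y b) ^ 2 ≤ n * (2 * energy G y) := by
    have key : ∀ (y : V → ℝ) (a b : V), y b ≤ y a → (y a - y b) ^ 2 ≤ n * (2 * energy G y) :=
      fun y a b hab => (sq_sub_le_card_mul_energy hG y (y b) hab le_rfl).trans (by
        have := energy_nonneg G y
        gcongr
        exact Nat.cast_le.2 (Finset.card_le_univ _))
    intro y a b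
    rcases le_total (y b) (y a) with h | h
    · exact key y a b h
    · rw [← neg_sub, neg_sq]; exact key y b a h
  calc ε ^ 2 ≤ (∑ u, x u * (g u v - g u w)) ^ 2 := by
        rw [← h1]; exact pow_le_pow_left₀ hε hvw.le 2
    _ ≤ n * ∑ u, (x u * (g u v - g u w)) ^ 2 := by
        simpa using sq_sum_le_card_mul_sum_sq (s := Finset.univ)
          (f := fun u => x u * (g u v - g u w))
    _ ≤ n * ∑ u, n * (2 * energy G (g u)) := by
        gcongr with u
        rw [mul_pow]
        refine le_trans (mul_le_of_le_one_left (sq_nonneg _) ?_) (h2 (g u) v w)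
        exact pow_le_one₀ (hx u).1 (hx u).2
    _ = _ := by simp_rw [← Finset.mul_sum]; ring

/-- Exponential convergence to consensus for arbitrary initial opinions. -/
lemma IsDeGrootDynamics.measureReal_largeOsc_le (hD : IsDeGrootDynamics (simpleRandomWalk G) N f P)
    (hf : ∀ v, ∀ᵐ ω ∂P, f 0 v ω ∈ Set.Icc (0 : ℝ) 1) (hG : G.Connected) (hΔ : 1 ≤ G.maxDegree)
    {ε : ℝ} (hε : 0 < ε) (T : ℝ≥0) :
    P.real {ω | (fun v => f T v ω) ∈ largeOsc V ε}
      ≤ 2 * (Fintype.card V : ℝ) ^ 3 * G.maxDegree / ε ^ 2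
        * Real.exp (-(T / (4 * Fintype.card V ^ 2 * G.maxDegree))) := by
  have := hG.nonempty
  have hn : (1 : ℝ) ≤ Fintype.card V := by exact_mod_cast Fintype.card_pos
  have hΔ' : (1 : ℝ) ≤ G.maxDegree := by exact_mod_cast hΔ
  have hdeg : ∀ u, (G.degree u : ℝ) ≤ G.maxDegree := fun u =>
    Nat.cast_le.2 (G.degree_le_maxDegree u)
  set n : ℝ := ((Fintype.card V : ℕ) : ℝ)
  set Δ : ℝ := ((G.maxDegree : ℕ) : ℝ)
  set K := simpleRandomWalk G
  refine hD.measureReal_le_of_forall_pattern T (measurableSet_largeOsc ε) fun m h hmh hh => ?_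
  have hmh' : (m : ℝ) * h = T := by exact_mod_cast congrArg NNReal.toReal hmh
  have hσ : ∀ σ : Fin m → Option V, P.real {ω | ringUpdates K m σ (fun v => f 0 v ω) ∈ largeOsc V ε}
      ≤ 2 * n ^ 2 / ε ^ 2 * ∑ u, energy G (ringUpdates K m σ (Pi.single u 1)) := by
    intro σ
    have hE : 0 ≤ ∑ u, energy G (ringUpdates K m σ (Pi.single u 1)) :=
      Finset.sum_nonneg fun _ _ => energy_nonneg G _
    -- For a fixed pattern the energies are deterministic: either the claimed bound is at least 1,
    -- or the event is null.
    by_cases hle : ε ^ 2 ≤ 2 * n ^ 2 * ∑ u, energy G (ringUpdates K m σ (Pi.single u 1))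
    · refine measureReal_le_one.trans ?_
      rw [div_mul_eq_mul_div, le_div_iff₀ (by positivity)]
      linarith
    · have h0 : P {ω | ringUpdates K m σ (fun v => f 0 v ω) ∈ largeOsc V ε} = 0 := by
        refine measure_mono_null_ae ?_ measure_empty
        filter_upwards [ae_all_iff.2 hf] with ω hω hosc
        exact hle (sq_le_sum_energy_of_mem_largeOsc hG σ hω hε.le hosc)
      rw [measureReal_def, h0, ENNReal.toReal_zero]
      positivity
  have hκ1 : h / (4 * n ^ 2 * Δ) ≤ 1 := by
    rw [div_le_one (by positivity)]
    have : 1 ≤ n ^ 2 * Δ := one_le_mul_of_one_le_of_one_le (one_le_pow₀ hn) hΔ'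
    have : (0 : ℝ) ≤ h := h.2
    nlinarith
  have hpow : (1 - h / (4 * n ^ 2 * Δ)) ^ m ≤ Real.exp (-(T / (4 * n ^ 2 * Δ))) := by
    calc (1 - h / (4 * n ^ 2 * Δ)) ^ m ≤ Real.exp (-(h / (4 * n ^ 2 * Δ))) ^ m :=
          pow_le_pow_left₀ (by linarith) (Real.one_sub_le_exp_neg _) m
      _ = _ := by
          rw [← Real.exp_nat_mul, ← hmh']
          congr 1
          ring
  calc ∑ σ : Fin m → Option V, patternWeight h σ
          * P.real {ω | ringUpdates K m σ (fun v => f 0 v ω) ∈ largeOsc V ε}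
      ≤ ∑ σ : Fin m → Option V, patternWeight h σ
          * (2 * n ^ 2 / ε ^ 2 * ∑ u, energy G (ringUpdates K m σ (Pi.single u 1))) :=
        Finset.sum_le_sum fun σ _ =>
          mul_le_mul_of_nonneg_left (hσ σ) (patternWeight_nonneg h.2 σ)
    _ = 2 * n ^ 2 / ε ^ 2 * ∑ u, ∑ σ : Fin m → Option V,
          patternWeight h σ * energy G (ringUpdates K m σ (Pi.single u 1)) := by
        rw [Finset.sum_comm]
        simp_rw [Finset.mul_sum]
        exact Finset.sum_congr rfl fun σ _ => Finset.sum_congr rfl fun u _ => by ring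
    _ ≤ 2 * n ^ 2 / ε ^ 2 * ∑ _u : V, Real.exp (-(T / (4 * n ^ 2 * Δ))) * Δ := by
        gcongr with u
        refine (sum_patternWeight_mul_energy_le hG hΔ h.2 hh m _).trans ?_
        rw [energy_single]
        exact mul_le_mul hpow (hdeg u) (Nat.cast_nonneg _) (Real.exp_pos _).le
    _ = _ := by simp [n]; ring

/-- Rapid convergence to consensus for i.i.d. initial opinions. -/
lemma IsDeGrootDynamics.measureReal_largeOsc_le_of_iid
    (hD : IsDeGrootDynamics (simpleRandomWalk G) N f P) (hf : IIDInit (f 0) P) (hG : G.Connected)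
    (hd : ∀ v, 0 < G.degree v) {ε δ L : ℝ} (hε : 0 < ε) (hδ : 0 < δ) (hδ1 : δ ≤ 1) (hL : 1 ≤ L)
    (hn : 2 * L / δ < Fintype.card V) (T : ℝ≥0) :
    P.real {ω | (fun v => f T v ω) ∈ largeOsc V ε}
      ≤ Fintype.card V * (2 * Real.exp (-(T * (δ ^ 6 / (16384 * G.maxDegree * L ^ 3))))
          + 2 * Real.exp (-(L / (16 * G.maxDegree))))
        + 2 * Fintype.card V * Real.exp (-(ε ^ 2 / (2 * δ))) := by
  have := hG.nonempty
  have hcard : (1 : ℝ) ≤ Fintype.card V := by exact_mod_cast Fintype.card_pos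
  have hΔ : (1 : ℝ) ≤ G.maxDegree := by
    obtain ⟨u⟩ := hG.nonempty
    exact_mod_cast (hd u).trans_le (G.degree_le_maxDegree u)
  set n : ℝ := ((Fintype.card V : ℕ) : ℝ)
  set Δ : ℝ := ((G.maxDegree : ℕ) : ℝ)
  set K := simpleRandomWalk G
  set b : ℝ := 2 * n * Real.exp (-(ε ^ 2 / (2 * δ)))
  refine hD.measureReal_le_of_forall_pattern T (measurableSet_largeOsc ε) fun m h hmh hh => ?_
  have hmh' : (m : ℝ) * h = T := by exact_mod_cast congrArg NNReal.toReal hmh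
  have hb : 0 ≤ b := by positivity
  have hσ : ∀ σ : Fin m → Option V, P.real {ω | ringUpdates K m σ (fun v => f 0 v ω) ∈ largeOsc V ε}
      ≤ (∑ u, if ∃ v, δ < ringUpdates K m σ (Pi.single u 1) v then (1 : ℝ) else 0) + b := by
    intro σ
    by_cases hex : ∃ u v, δ < ringUpdates K m σ (Pi.single u 1) v
    · obtain ⟨u, hu⟩ := hex
      have h1 := Finset.single_le_sum (f := fun u => if ∃ v, δ < ringUpdates K m σ (Pi.single u 1) v
        then (1 : ℝ) else 0) (fun u _ => by split_ifs <;> norm_num) (Finset.mem_univ u)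
      simp only [if_pos hu] at h1
      exact measureReal_le_one.trans (by linarith)
    · push Not at hex
      have h1 : 0 ≤ ∑ u, if ∃ v, δ < ringUpdates K m σ (Pi.single u 1) v then (1 : ℝ) else 0 :=
        Finset.sum_nonneg fun u _ => by split_ifs <;> norm_num
      refine le_trans ?_ (le_add_of_nonneg_left h1)
      refine measureReal_largeOsc_le_of_forall_le hf (fun v => hD.aemeasurable 0 v)
        (ringUpdates K m σ) (fun u => ringUpdates K m σ (Pi.single u 1)) hε
        (fun x v => ringUpdates_apply_eq_sum K m σ x v) (fun u v => ?_) (fun v => ?_) hex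
      · exact ringUpdates_induction K (fun g => 0 ≤ g) (fun o g hg => ringUpdate_nonneg o hg) m σ _
          (by simp) v
      · have h2 : ringUpdates K m σ 1 = 1 :=
          ringUpdates_induction K (fun g => g = 1)
            (fun o g hg => by rw [hg]; exact ringUpdate_one hd o) m σ 1 rfl
        have h3 := ringUpdates_apply_eq_sum K m σ 1 v
        rw [h2] at h3
        simpa using h3.symm
  set q : ℝ := δ ^ 6 / (16384 * Δ * L ^ 3)
  have hq0 : 0 ≤ q := by positivity
  have hq1 : h * q ≤ 1 := by
    have h1 : q ≤ 1 := by
      simp only [q]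
      rw [div_le_one (by positivity)]
      have : 1 ≤ Δ * L ^ 3 := one_le_mul_of_one_le_of_one_le hΔ (one_le_pow₀ hL)
      have : δ ^ 6 ≤ 1 := pow_le_one₀ hδ.le hδ1
      nlinarith
    have h0 : (0 : ℝ) ≤ h := h.2
    exact mul_le_one₀ (by nlinarith) hq0 h1
  have hpow : (1 - h * q) ^ m ≤ Real.exp (-(T * q)) := by
    calc (1 - h * q) ^ m ≤ Real.exp (-(h * q)) ^ m :=
          pow_le_pow_left₀ (by linarith) (Real.one_sub_le_exp_neg _) m
      _ = _ := by
          rw [← Real.exp_nat_mul, ← hmh']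
          congr 1
          ring
  calc ∑ σ : Fin m → Option V, patternWeight h σ
          * P.real {ω | ringUpdates K m σ (fun v => f 0 v ω) ∈ largeOsc V ε}
      ≤ ∑ σ : Fin m → Option V, patternWeight h σ
          * ((∑ u, if ∃ v, δ < ringUpdates K m σ (Pi.single u 1) v then (1 : ℝ) else 0) + b) :=
        Finset.sum_le_sum fun σ _ =>
          mul_le_mul_of_nonneg_left (hσ σ) (patternWeight_nonneg h.2 σ)
    _ = ∑ u, ∑ σ : Fin m → Option V, patternWeight h σ
          * (if ∃ v, δ < ringUpdates K m σ (Pi.single u 1) v then (1 : ℝ) else 0)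
        + (∑ σ : Fin m → Option V, patternWeight (V := V) h σ) * b := by
        rw [Finset.sum_comm, Finset.sum_mul, ← Finset.sum_add_distrib]
        exact Finset.sum_congr rfl fun σ _ => by rw [mul_add, Finset.mul_sum]
    _ ≤ ∑ _u : V, (2 * Real.exp (-(T * q)) + 2 * Real.exp (-(L / (16 * Δ)))) + 1 * b := by
        gcongr with u
        · exact (sum_patternWeight_single_gt_le hG hd h.2 hh hδ hδ1 hL hn m u).trans
            (add_le_add (mul_le_mul_of_nonneg_left hpow zero_le_two) le_rfl)
        · exact sum_patternWeight_le_one h.2 m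
    _ = _ := by simp [n, b, q, mul_add]

end FixedTime

/-! ### Interpolating the two tail bounds -/

section Summation

/-- From T₀ on, b k is at most the geometric mean √(pA)·e^{-yk} of its two bounds; the earlier terms
cost at most 1 each. -/
lemma tsum_ofReal_le {b : ℕ → ℝ} {A p y : ℝ} (T₀ : ℕ) (hb0 : ∀ k, 0 ≤ b k) (hb1 : ∀ k, b k ≤ 1)
    (hA : ∀ k : ℕ, b k ≤ A * Real.exp (-(2 * y * k))) (hp : ∀ k, T₀ ≤ k → b k ≤ p) (hp0 : 0 ≤ p)
    (hA0 : 0 ≤ A) (hy : 0 < y) :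
    ∑' k, ENNReal.ofReal (b k) ≤ ENNReal.ofReal (T₀ + √(p * A) * (1 + 1 / y)) := by
  set c : ℕ → ℝ := fun k => (if k ∈ Finset.range T₀ then 1 else 0) + √(p * A) * Real.exp (-y) ^ k
  have hlt : Real.exp (-y) < 1 := by simpa using hy
  have hsum : HasSum c (T₀ + √(p * A) * (1 - Real.exp (-y))⁻¹) := by
    have h1 : HasSum (fun k => if k ∈ Finset.range T₀ then (1 : ℝ) else 0) T₀ := by
      have := hasSum_sum_of_ne_finset_zero (s := Finset.range T₀) (L := .unconditional ℕ)
        (f := fun k => if k ∈ Finset.range T₀ then (1 : ℝ) else 0) fun k hk => if_neg hk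
      rwa [Finset.sum_congr rfl fun k hk => if_pos hk, Finset.sum_const, Finset.card_range,
        nsmul_one] at this
    exact h1.add ((hasSum_geometric_of_lt_one (Real.exp_pos _).le hlt).mul_left _)
  have hc0 : ∀ k, 0 ≤ c k := fun k => by
    simp only [c]
    split_ifs <;> positivity
  have hbc : ∀ k, b k ≤ c k := by
    intro k
    have hg : 0 ≤ √(p * A) * Real.exp (-y) ^ k := by positivity
    by_cases hk : k < T₀
    · simp only [c, Finset.mem_range, hk, if_true]
      linarith [hb1 k]
    · simp only [c, Finset.mem_range, hk, if_false, zero_add]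
      refine le_of_abs_le (abs_le_of_sq_le_sq ?_ hg)
      have hexp : Real.exp (-(2 * y * k)) = (Real.exp (-y) ^ k) ^ 2 := by
        rw [← pow_mul, ← Real.exp_nat_mul]; push_cast; congr 1; ring
      rw [mul_pow, Real.sq_sqrt (by positivity), ← hexp, sq]
      calc b k * b k ≤ p * (A * Real.exp (-(2 * y * k))) :=
            mul_le_mul (hp k (not_lt.1 hk)) (hA k) (hb0 k) hp0
        _ = _ := by ring
  calc ∑' k, ENNReal.ofReal (b k) ≤ ∑' k, ENNReal.ofReal (c k) :=
        ENNReal.tsum_le_tsum fun k => ENNReal.ofReal_le_ofReal (hbc k)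
    _ = ENNReal.ofReal (T₀ + √(p * A) * (1 - Real.exp (-y))⁻¹) := by
        rw [← ENNReal.ofReal_tsum_of_nonneg hc0 hsum.summable, hsum.tsum_eq]
    _ ≤ _ := by
        apply ENNReal.ofReal_le_ofReal
        gcongr
        have h1 : Real.exp (-y) * (1 + y) ≤ 1 := by
          rw [Real.exp_neg, inv_mul_le_iff₀ (Real.exp_pos _), mul_one, add_comm]
          exact Real.add_one_le_exp _
        rw [inv_le_iff_one_le_mul₀ (by linarith)]
        have h2 : (1 + 1 / y) * (1 - Real.exp (-y)) = (1 + y - Real.exp (-y) * (1 + y)) / y := by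
          field_simp
          ring
        rw [h2, le_div_iff₀ hy]
        linarith

end Summation

/-! ### Expected consensus time -/

section Main

variable {V Ω : Type*} [Fintype V] [MeasurableSpace Ω] {P : Measure Ω}
  {N : V → ℝ≥0 → Ω → ℕ} {f : ℝ≥0 → V → Ω → ℝ}

lemma lintegral_consensusTime_eq_zero [Nonempty V]
    (hf : ∀ v, ∀ᵐ ω ∂P, f 0 v ω ∈ Set.Icc (0 : ℝ) 1) {ε : ℝ} (hε : 1 ≤ ε) :
    ∫⁻ ω, consensusTime ε (fun t v => f t v ω) ∂P = 0 := by
  refine lintegral_eq_zero_of_ae_eq_zero ?_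
  filter_upwards [ae_all_iff.2 hf] with ω hω
  have hosc : osc (fun v => f 0 v ω) ≤ ε := osc_le_of_notMem_largeOsc (by
    rintro ⟨v, w, h⟩
    linarith [(hω v).2, (hω w).1])
  have := iInf₂_le (α := ℝ≥0∞) (f := fun (t : ℝ≥0) (_ : osc (fun v => f t v ω) ≤ ε) => (t : ℝ≥0∞))
    0 hosc
  simpa [consensusTime] using this

variable [IsProbabilityMeasure P] {G : SimpleGraph V} [DecidableRel G.Adj]

/-- A bound on the expected consensus time in terms of a bound on the probability that the
oscillation is still large after a given time. -/
lemma IsDeGrootDynamics.lintegral_consensusTime_le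
    (hD : IsDeGrootDynamics (simpleRandomWalk G) N f P)
    (hf : ∀ v, ∀ᵐ ω ∂P, f 0 v ω ∈ Set.Icc (0 : ℝ) 1) (hG : G.Connected) (hΔ : 1 ≤ G.maxDegree)
    {ε p : ℝ} (hε : 0 < ε) (hp0 : 0 ≤ p) (T₀ : ℕ)
    (hp : ∀ k : ℕ, T₀ ≤ k → P.real {ω | (fun v => f k v ω) ∈ largeOsc V ε} ≤ p) :
    ∫⁻ ω, consensusTime ε (fun t v => f t v ω) ∂P
      ≤ ENNReal.ofReal (T₀ + √(p * (2 * (Fintype.card V : ℝ) ^ 3 * G.maxDegree / ε ^ 2))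
          * (1 + 8 * Fintype.card V ^ 2 * G.maxDegree)) := by
  classical
  have := hG.nonempty
  have hn : (0 : ℝ) < Fintype.card V := by exact_mod_cast Fintype.card_pos
  have hΔ' : (0 : ℝ) < G.maxDegree := by exact_mod_cast hΔ
  refine (DeGroot.lintegral_consensusTime_le hD.aemeasurable ε).trans ?_
  have h1 := tsum_ofReal_le (b := fun k : ℕ => P.real {ω | (fun v => f k v ω) ∈ largeOsc V ε})
    (A := 2 * (Fintype.card V : ℝ) ^ 3 * G.maxDegree / ε ^ 2) (p := p)
    (y := 1 / (8 * Fintype.card V ^ 2 * G.maxDegree)) T₀ (fun k => measureReal_nonneg)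
    (fun k => measureReal_le_one) (fun k => ?_) hp hp0 (by positivity) (by positivity)
  · rw [one_div_one_div] at h1
    refine le_trans (le_of_eq (tsum_congr fun k => ?_)) h1
    rw [ofReal_measureReal]
  · refine (hD.measureReal_largeOsc_le hf hG hΔ hε k).trans_eq ?_
    congr 3
    push_cast
    field_simp
    ring

lemma IsDeGrootDynamics.lintegral_consensusTime_le_pow
    (hD : IsDeGrootDynamics (simpleRandomWalk G) N f P) (hf : IIDInit (f 0) P) (hG : G.Connected)
    {ε : ℝ} (hε : 0 < ε) (hε1 : ε < 1) (hΔ : G.maxDegree ≤ Real.log (Fintype.card V))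
    (hn : 20000 ≤ Real.log (Fintype.card V)) :
    ∫⁻ ω, consensusTime ε (fun t v => f t v ω) ∂P
      ≤ ENNReal.ofReal ((ε⁻¹ * Real.log (Fintype.card V)) ^ 23) := by
  classical
  have := hG.nonempty
  have hn0 : (0 : ℝ) < Fintype.card V := by exact_mod_cast Fintype.card_pos
  have hlogn : Real.log (Fintype.card V) ≤ Fintype.card V := Real.log_le_self hn0.le
  have : Nontrivial V := by
    have h1 : (1 : ℝ) < Fintype.card V := by linarith
    exact Fintype.one_lt_card_iff_nontrivial.1 (by exact_mod_cast h1)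
  have hd : ∀ v, 0 < G.degree v := degree_pos_of_connected hG
  have hΔ1 : 1 ≤ G.maxDegree := by
    obtain ⟨u⟩ := hG.nonempty
    exact (hd u).trans_le (G.degree_le_maxDegree u)
  have hΔ1' : (1 : ℝ) ≤ G.maxDegree := by exact_mod_cast hΔ1
  have hmain := fun (p : ℝ) (hp : 0 ≤ p) (T₀ : ℕ) =>
    hD.lintegral_consensusTime_le hf.mem_Icc hG hΔ1 hε hp T₀
  have hiid := fun (δ L : ℝ) => hD.measureReal_largeOsc_le_of_iid hf hG hd (δ := δ) (L := L) hε
  have hexp : Real.exp (-(12 * Real.log (Fintype.card V))) = ((Fintype.card V : ℝ) ^ 12)⁻¹ := by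
    rw [Real.exp_neg, ← Real.exp_log (pow_pos hn0 12), Real.log_pow]
    norm_num
  set n : ℝ := ((Fintype.card V : ℕ) : ℝ)
  set ℓ : ℝ := Real.log n
  set D : ℝ := ((G.maxDegree : ℕ) : ℝ)
  set e : ℝ := ε⁻¹
  have he : 1 ≤ e := (one_le_inv₀ hε).2 hε1.le
  have heε : e * ε = 1 := inv_mul_cancel₀ hε.ne'
  set x : ℝ := e * ℓ
  have hℓx : ℓ ≤ x := le_mul_of_one_le_left (by linarith) he
  have hex : e ≤ x := le_mul_of_one_le_right (by linarith) (by linarith)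
  have hx1 : 20000 ≤ x := hn.trans hℓx
  have hDx : D ≤ x := hΔ.trans hℓx
  have hℓ0 : 0 < ℓ := by linarith
  have hx0 : 0 < x := by linarith
  have hdiv : ∀ a : ℝ, a / ε ^ 2 = a * e ^ 2 := fun a => by
    simp only [e]; field_simp
  -- The threshold is 2L/δ for the δ and L chosen below. Under it n ≤ x^4, and the slow decay alone,
  -- with p = 1 and T₀ = 0, is enough.
  by_cases hcase : n ≤ 9216 * D * ℓ ^ 2 / ε ^ 2
  · refine (hmain 1 zero_le_one 0 fun k _ => measureReal_le_one).trans
      (ENNReal.ofReal_le_ofReal ?_)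
    have hnx : n ≤ x ^ 4 := by
      rw [hdiv] at hcase
      calc n ≤ 9216 * D * ℓ ^ 2 * e ^ 2 := hcase
        _ ≤ x * x * ℓ ^ 2 * e ^ 2 := by gcongr; linarith
        _ = x ^ 4 := by simp only [x]; ring
    have hsqrt : √(1 * (2 * n ^ 3 * D / ε ^ 2)) ≤ x ^ 8 := by
      rw [hdiv, Real.sqrt_le_left (by positivity)]
      calc 1 * (2 * n ^ 3 * D * e ^ 2) = 2 * n ^ 3 * D * e ^ 2 := one_mul _
        _ ≤ x * (x ^ 4) ^ 3 * x * x ^ 2 := by gcongr; linarith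
        _ = (x ^ 8) ^ 2 := by ring
    have hrest : 1 + 8 * n ^ 2 * D ≤ x ^ 10 := by
      have h1 : n ^ 2 * D ≤ x ^ 9 := by
        calc n ^ 2 * D ≤ (x ^ 4) ^ 2 * x := by gcongr
          _ = x ^ 9 := by ring
      have h2 : 1 ≤ x ^ 9 := one_le_pow₀ (by linarith)
      have h3 : x ^ 10 = x * x ^ 9 := by ring
      nlinarith
    calc ((0 : ℕ) : ℝ) + √(1 * (2 * n ^ 3 * D / ε ^ 2)) * (1 + 8 * n ^ 2 * D)
        ≤ 0 + x ^ 8 * x ^ 10 := by rw [Nat.cast_zero]; gcongr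
      _ = x ^ 18 := by ring
      _ ≤ x ^ 23 := pow_le_pow_right₀ (by linarith) (by norm_num)
  · push Not at hcase
    -- With these δ and L both ε²/(2δ) and L/(16D) equal 12ℓ, so each error exponential is n^{-12}.
    set δ : ℝ := ε ^ 2 / (24 * ℓ)
    set L : ℝ := 192 * D * ℓ
    have hδ : 0 < δ := by positivity
    have hδ1 : δ ≤ 1 := by
      rw [div_le_one (by positivity)]
      nlinarith
    have hL : 1 ≤ L := by
      have : 1 ≤ D * ℓ := one_le_mul_of_one_le_of_one_le hΔ1' (by linarith)
      simp only [L]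
      linarith
    have hLδ : 2 * L / δ < n := by
      refine lt_of_eq_of_lt ?_ hcase
      simp only [L, δ]
      field_simp
      ring
    -- Twelve powers of x cancel the ε^{12} in δ^6; the other ten absorb D·L³ and, as ℓ ≥ 20000, the
    -- numerical constants.
    set T₀ : ℕ := ⌈x ^ 22⌉₊
    have hT₀ : x ^ 22 ≤ T₀ := Nat.le_ceil _
    have hrate : ∀ k : ℕ, T₀ ≤ k → 12 * ℓ ≤ (k : ℝ) * (δ ^ 6 / (16384 * D * L ^ 3)) := by
      intro k hk
      have hk' : x ^ 22 ≤ k := hT₀.trans (Nat.cast_le.2 hk)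
      refine le_trans ?_ (mul_le_mul_of_nonneg_right hk' (by positivity))
      rw [← mul_div_assoc, le_div_iff₀ (by positivity)]
      have h1 : x ^ 22 * δ ^ 6 = x ^ 10 * ℓ ^ 6 / 24 ^ 6 := by
        have : x ^ 22 * ε ^ 12 = x ^ 10 * ℓ ^ 12 := by
          have h2 : x * ε = ℓ := by simp only [x]; linear_combination ℓ * heε
          rw [← h2]; ring
        have h3 : δ ^ 6 = ε ^ 12 / (24 ^ 6 * ℓ ^ 6) := by simp only [δ]; ring
        rw [h3, ← mul_div_assoc, this]
        field_simp
      rw [h1, le_div_iff₀ (by positivity)]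
      have h4 : (24 ^ 6 * 12 * 16384 * 192 ^ 3 : ℝ) ≤ ℓ ^ 5 := by
        refine le_trans ?_ (pow_le_pow_left₀ (by norm_num) hn 5)
        norm_num
      calc 12 * ℓ * (16384 * D * L ^ 3) * 24 ^ 6
          = (24 ^ 6 * 12 * 16384 * 192 ^ 3) * (D ^ 4 * ℓ ^ 4) := by simp only [L]; ring
        _ ≤ ℓ ^ 5 * (ℓ ^ 4 * ℓ ^ 4) := by gcongr
        _ ≤ ℓ ^ 5 * (ℓ ^ 4 * ℓ ^ 4) * ℓ ^ 3 :=
            le_mul_of_one_le_right (by positivity) (one_le_pow₀ (by linarith))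
        _ = ℓ ^ 10 * ℓ ^ 6 := by ring
        _ ≤ x ^ 10 * ℓ ^ 6 := by gcongr
    have hp : ∀ k : ℕ, T₀ ≤ k → P.real {ω | (fun v => f k v ω) ∈ largeOsc V ε}
        ≤ 6 * n * (n ^ 12)⁻¹ := by
      intro k hk
      refine (hiid δ L hδ hδ1 hL hLδ k).trans ?_
      have h1 : Real.exp (-((k : ℝ) * (δ ^ 6 / (16384 * D * L ^ 3)))) ≤ (n ^ 12)⁻¹ := by
        rw [← hexp]; exact Real.exp_le_exp.2 (neg_le_neg (hrate k hk))
      have h2 : Real.exp (-(L / (16 * D))) = (n ^ 12)⁻¹ := by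
        rw [← hexp]; congr 2; simp only [L]; field_simp; ring
      have h3 : Real.exp (-(ε ^ 2 / (2 * δ))) = (n ^ 12)⁻¹ := by
        rw [← hexp]; congr 2; simp only [δ]; field_simp; ring
      rw [h2, h3, NNReal.coe_natCast]
      calc n * (2 * Real.exp (-((k : ℝ) * (δ ^ 6 / (16384 * D * L ^ 3)))) + 2 * (n ^ 12)⁻¹)
            + 2 * n * (n ^ 12)⁻¹
          ≤ n * (2 * (n ^ 12)⁻¹ + 2 * (n ^ 12)⁻¹) + 2 * n * (n ^ 12)⁻¹ := by gcongr
        _ = _ := by ring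
    refine (hmain _ (by positivity) T₀ hp).trans (ENNReal.ofReal_le_ofReal ?_)
    have hDn : D ≤ n := hΔ.trans hlogn
    -- The factor n^{-12} beats the polynomial prefactors, leaving 972·D³ ≤ n^4; the whole tail then
    -- costs at most e.
    have hsqrt : √(6 * n * (n ^ 12)⁻¹ * (2 * n ^ 3 * D / ε ^ 2)) ≤ e / (9 * n ^ 2 * D) := by
      rw [hdiv, Real.sqrt_le_left (by positivity), div_pow, le_div_iff₀ (by positivity)]
      have h1 : 6 * n * (n ^ 12)⁻¹ * (2 * n ^ 3 * D * e ^ 2) * (9 * n ^ 2 * D) ^ 2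
          = 972 * D ^ 3 / n ^ 4 * e ^ 2 := by
        field_simp
        ring
      rw [h1]
      refine mul_le_of_le_one_left (by positivity) ?_
      rw [div_le_one (by positivity)]
      calc 972 * D ^ 3 ≤ n * n ^ 3 := by gcongr; linarith
        _ = n ^ 4 := by ring
    have hrest : 1 + 8 * n ^ 2 * D ≤ 9 * n ^ 2 * D := by
      have : 1 ≤ n ^ 2 * D :=
        one_le_mul_of_one_le_of_one_le (one_le_pow₀ (by linarith)) hΔ1'
      linarith
    calc (T₀ : ℝ) + √(6 * n * (n ^ 12)⁻¹ * (2 * n ^ 3 * D / ε ^ 2)) * (1 + 8 * n ^ 2 * D)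
        ≤ (x ^ 22 + 1) + e / (9 * n ^ 2 * D) * (9 * n ^ 2 * D) := by
          refine add_le_add (Nat.ceil_lt_add_one (by positivity)).le ?_
          gcongr
      _ = x ^ 22 + 1 + e := by rw [div_mul_cancel₀ _ (by positivity)]
      _ ≤ x ^ 23 := by
          have h1 : x ≤ x ^ 22 := le_self_pow₀ (by linarith) (by norm_num)
          have h2 : x ^ 23 = x * x ^ 22 := by ring
          nlinarith

end Main

end DeGroot

theorem theorem1p3 :
    ∃ C : ℝ, 0 < C ∧ ∀ Δ : ℕ, ∃ n₀ : ℕ,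
      ∀ (V : Type*) [Fintype V] (G : SimpleGraph V) [DecidableRel G.Adj],
        G.Connected → G.maxDegree = Δ → n₀ ≤ Fintype.card V →
      ∀ (Ω : Type*) [MeasurableSpace Ω] (P : Measure Ω) [IsProbabilityMeasure P]
        (N : V → ℝ≥0 → Ω → ℕ) (f : ℝ≥0 → V → Ω → ℝ),
        DeGroot.IsDeGrootDynamics (DeGroot.simpleRandomWalk G) N f P →
        DeGroot.IIDInit (f 0) P →
      ∀ ε : ℝ, 0 < ε →
        ∫⁻ ω, DeGroot.consensusTime ε (fun t v => f t v ω) ∂P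
          ≤ ENNReal.ofReal ((ε⁻¹ * Real.log (Fintype.card V)) ^ C) := by
  -- This n₀ forces log n ≥ Δ and log n ≥ 20000, so powers of Δ and constants turn into powers of
  -- log n with an exponent free of Δ.
  refine ⟨23, by norm_num, fun Δ => ⟨⌈Real.exp (max Δ 20000)⌉₊, ?_⟩⟩
  intro V _ G _ hG hΔ hn Ω _ P _ N f hD hf ε hε
  have := hG.nonempty
  rcases le_or_gt 1 ε with hε1 | hε1
  · rw [DeGroot.lintegral_consensusTime_eq_zero hf.mem_Icc hε1]
    exact bot_le
  · have hlog : max (Δ : ℝ) 20000 ≤ Real.log (Fintype.card V) := by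
      rw [Real.le_log_iff_exp_le (by exact_mod_cast Fintype.card_pos)]
      exact Nat.ceil_le.1 hn
    have h := hD.lintegral_consensusTime_le_pow hf hG hε hε1
      (by rw [hΔ]; exact (le_max_left _ _).trans hlog) ((le_max_right _ _).trans hlog)
    refine h.trans_eq ?_
    rw [← Real.rpow_natCast]
    norm_num
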